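/- Let $\mathbb{H}^+=\{(x,y)\in\mathbb{R}^2 : x>0\}$ and let $\mathcal{D}(\mathbb{H}^+)$ be the space of complex-valued $C^\infty$ functions with compact support in $\mathbb{H}^+$. For $m\in\mathbb{C}$, let $L_m$ be the Weinstein operator and $L_m^\star$ its adjoint, acting on complex distributions $T$ on $\mathbb{H}^+$ by $$L_mT=\Delta T+\frac{m}{x}\,\partial_xT,\qquad L_m^\star T=\Delta T-\partial_x\Big(\frac{m}{x}\,T\Big),$$ where $\Delta=\partial_x^2+\partial_y^2$ and $\langle \partial T,\varphi\rangle=-\langle T,\partial\varphi\rangle$. Subscripts as in $L_{m,x,y}$ or $L^\star_{m,\xi,\eta}$ name the variables in which the operator acts, the others being fixed. Let $\delta_a$ denote the Dirac mass at $a$. For distinct points $(x,y),(\xi,\eta)\in\mathbb{H}^+$ put $$E_m(x,y,\xi,\eta)=-\frac{\xi^m}{2\pi}\int_0^\pi\frac{\sin^{m-1}\theta\,d\theta}{\left[(x-\xi)^2+4x\xi\sin^2\left(\frac\theta2\right)+(y-\eta)^2\right]^{m/2}}\qquad\text{if } \operatorname{Re} m\ge 1,$$ $$E_m(x,y,\xi,\eta)=-\frac{\xi\,x^{1-m}}{2\pi}\int_0^\pi\frac{\sin^{1-m}\theta\,d\theta}{\left[(x-\xi)^2+4x\xi\sin^2\left(\frac\theta2\right)+(y-\eta)^2\right]^{1-\frac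 m2}}\qquad\text{if } \operatorname{Re} m<1.$$ Theorem. Let $m\in\mathbb{C}$. 1. The integral defining $E_m(x,y,\xi,\eta)$ converges absolutely whenever $(x,y)\neq(\xi,\eta)$ in $\mathbb{H}^+$. 2. If $\operatorname{Re} m<1$, then $E_m(x,y,\xi,\eta)=\left(\frac{\xi}{x}\right)^{m-1}E_{2-m}(x,y,\xi,\eta)$. 3. For every fixed $(x,y)\in\mathbb{H}^+$, the function $(\xi,\eta)\mapsto E_m(x,y,\xi,\eta)$ is locally integrable on $\mathbb{H}^+$ and, in the sense of distributions on $\mathbb{H}^+$, $$L^\star_{m,\xi,\eta}E_m(x,y,\cdot,\cdot)=\delta_{(x,y)}.$$ 4. For every fixed $(\xi,\eta)\in\mathbb{H}^+$, the function $(x,y)\mapsto E_m(x,y,\xi,\eta)$ is locally integrable on $\mathbb{H}^+$ and, in the sense of distributions on $\mathbb{H}^+$, $$L_{m,x,y}E_m(\cdot,\cdot,\xi,\eta)=\delta_{(\xi,\eta)}.$$ -/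

import Mathlib

namespace Weinstein

open scoped Distributions ContDiff Manifold

noncomputable section

/-- The right half-plane `{(x, y) ∈ ℝ² : x > 0}`, as an open set. -/
def halfPlane : TopologicalSpace.Opens (ℝ × ℝ) :=
  ⟨{p | 0 < p.1}, isOpen_lt continuous_const continuous_fst⟩

/-- Complex distributions on an open set `Ω` of the plane: continuous `ℂ`-linear functionals on the
space `𝓓(Ω, ℂ)` of complex-valued test functions with its LF topology. -/
abbrev Distr (Ω : TopologicalSpace.Opens (ℝ × ℝ)) : Type := 𝓓(Ω, ℂ) →L[ℂ] ℂ

variable {Ω : TopologicalSpace.Opens (ℝ × ℝ)}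

/-- A smooth function on `Ω` agrees on a given compact subset of `Ω` with a smooth function on the
whole plane. -/
theorem exists_smooth_extension {g : ℝ × ℝ → ℂ} (hg : ContDiffOn ℝ ∞ g Ω)
    (K : TopologicalSpace.Compacts (ℝ × ℝ)) (hK : (K : Set (ℝ × ℝ)) ⊆ Ω) :
    ∃ G : ℝ × ℝ → ℂ, ContDiff ℝ ∞ G ∧ ∀ p ∈ K, G p = g p := by
  obtain ⟨χ, h0, h1, -⟩ := exists_contMDiffMap_zero_one_nhds_of_isClosed (n := ⊤)
    (𝓘(ℝ, ℝ × ℝ)) Ω.isOpen.isClosed_compl K.isCompact.isClosed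
    (Set.disjoint_compl_left_iff_subset.2 hK)
  have hχ : ContDiff ℝ ∞ χ := χ.contMDiff.contDiff
  refine ⟨fun p => (χ p : ℂ) * g p, ?_, fun p hp => ?_⟩
  · rw [contDiff_iff_contDiffAt]
    intro p
    by_cases hp : p ∈ Ω
    · exact (Complex.ofRealCLM.contDiff.comp hχ).contDiffAt.mul
        (hg.contDiffAt (Ω.isOpen.mem_nhds hp))
    · have hp' : ∀ᶠ q in nhds p, χ q = 0 := h0.filter_mono (nhds_le_nhdsSet hp)
      refine (contDiffAt_const (c := (0 : ℂ))).congr_of_eventuallyEq ?_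
      filter_upwards [hp'] with q hq
      simp [hq]
  · have : χ p = 1 := h1.self_of_nhdsSet p hp
    simp [this]

/-- The product of a test function on `Ω` with a function that is smooth on `Ω`. -/
def mulTest (g : ℝ × ℝ → ℂ) (hg : ContDiffOn ℝ ∞ g Ω) (φ : 𝓓(Ω, ℂ)) : 𝓓(Ω, ℂ) where
  toFun p := φ p * g p
  contDiff' := by
    obtain ⟨G, hG, hGg⟩ := exists_smooth_extension hg ⟨tsupport φ, φ.hasCompactSupport⟩
      φ.tsupport_subset
    have : (fun p => φ p * g p) = fun p => φ p * G p := by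
      funext p
      by_cases hp : p ∈ tsupport φ
      · rw [hGg p hp]
      · simp [image_eq_zero_of_notMem_tsupport hp]
    rw [this]
    exact φ.contDiff.mul hG
  hasCompactSupport' := φ.hasCompactSupport.mul_right
  tsupport_subset' := (tsupport_mul_subset_left).trans φ.tsupport_subset

/-- Multiplication of test functions on `Ω` by a function that is smooth on `Ω`, as a continuous
linear map. -/
def mulTestCLM (g : ℝ × ℝ → ℂ) (hg : ContDiffOn ℝ ∞ g Ω) : 𝓓(Ω, ℂ) →L[ℂ] 𝓓(Ω, ℂ) :=
  TestFunction.limitCLM ℂ (mulTest g hg)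
    (fun K hK => TestFunction.ofSupportedInCLM ℂ hK ∘L
      ContDiffMapSupportedIn.bilinLeftCLM (ContinuousLinearMap.mul ℂ ℂ)
        (exists_smooth_extension hg K hK).choose_spec.1)
    (fun K hK f => by
      ext p
      change f p * g p = f p * (exists_smooth_extension hg K hK).choose p
      by_cases hp : p ∈ K
      · rw [(exists_smooth_extension hg K hK).choose_spec.2 p hp]
      · simp [f.zero_on_compl hp])

/-- The product `g T` of a distribution `T` on `Ω` with a function `g` that is smooth on `Ω`. -/
def smulDistr (g : ℝ × ℝ → ℂ) (hg : ContDiffOn ℝ ∞ g Ω) (T : Distr Ω) : Distr Ω :=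
  T ∘L mulTestCLM g hg

/-- The derivative of a distribution in the direction `v`: `⟨∂_v T, φ⟩ = -⟨T, ∂_v φ⟩`. -/
def deriv (v : ℝ × ℝ) (T : Distr Ω) : Distr Ω :=
  -(T ∘L TestFunction.lineDerivCLM ℂ v)

/-- The partial derivative of a distribution with respect to the first coordinate. -/
def partial₁ (T : Distr Ω) : Distr Ω := deriv (1, 0) T

/-- The partial derivative of a distribution with respect to the second coordinate. -/
def partial₂ (T : Distr Ω) : Distr Ω := deriv (0, 1) T

/-- The distribution `φ ↦ ∫ φ f` of a function `f` that is locally integrable on `Ω` with respect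
to Lebesgue measure. (For other functions it is `0` by convention.) -/
def ofFun (f : ℝ × ℝ → ℂ) : Distr Ω :=
  TestFunction.integralAgainstBilinCLM (ContinuousLinearMap.mul ℂ ℂ) MeasureTheory.volume f

/-- The Dirac mass at the point `a`. -/
def dirac (a : ℝ × ℝ) : Distr Ω :=
  TestFunction.mkCLM ℂ (fun φ => φ a) (fun _ _ => rfl) (fun _ _ => rfl)
    (fun _ hK => (continuous_eval_const a).comp (TestFunction.continuous_ofSupportedIn hK))

theorem contDiffOn_coeff (m : ℂ) :
    ContDiffOn ℝ ∞ (fun p : ℝ × ℝ => m / (p.1 : ℂ)) halfPlane := by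
  simp only [div_eq_mul_inv]
  refine contDiffOn_const.mul (ContDiffOn.inv ?_ fun p hp => Complex.ofReal_ne_zero.2 (ne_of_gt hp))
  exact (Complex.ofRealCLM.contDiff.comp contDiff_fst).contDiffOn

/-- The Weinstein operator `L_m T = ∂₁² T + ∂₂² T + (m / x) ∂₁ T` on distributions, where `x` is the
first coordinate. -/
def weinstein (m : ℂ) (T : Distr halfPlane) : Distr halfPlane :=
  partial₁ (partial₁ T) + partial₂ (partial₂ T) +
    smulDistr (fun p => m / (p.1 : ℂ)) (contDiffOn_coeff m) (partial₁ T)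

/-- The adjoint Weinstein operator `L_m^⋆ T = ∂₁² T + ∂₂² T - ∂₁ ((m / x) T)` on distributions. -/
def weinsteinAdjoint (m : ℂ) (T : Distr halfPlane) : Distr halfPlane :=
  partial₁ (partial₁ T) + partial₂ (partial₂ T) -
    partial₁ (smulDistr (fun p => m / (p.1 : ℂ)) (contDiffOn_coeff m) T)

/-- `(x - ξ)² + 4 x ξ sin² (θ / 2) + (y - η)²`. -/
def bracket (x y ξ η θ : ℝ) : ℝ :=
  (x - ξ) ^ 2 + 4 * x * ξ * Real.sin (θ / 2) ^ 2 + (y - η) ^ 2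

/-- The integrand in the definition of `E_m`; powers with complex exponent are principal powers
of nonnegative real numbers. -/
def integrand (m : ℂ) (x y ξ η θ : ℝ) : ℂ :=
  if 1 ≤ m.re then
    (Real.sin θ : ℂ) ^ (m - 1) / (bracket x y ξ η θ : ℂ) ^ (m / 2)
  else
    (Real.sin θ : ℂ) ^ (1 - m) / (bracket x y ξ η θ : ℂ) ^ (1 - m / 2)

/-- The function `E_m(x, y, ξ, η)`. -/
def E (m : ℂ) (x y ξ η : ℝ) : ℂ :=
  if 1 ≤ m.re then
    -((ξ : ℂ) ^ m / (2 * (Real.pi : ℂ))) * ∫ θ in (0 : ℝ)..Real.pi, integrand m x y ξ η θ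
  else
    -((ξ : ℂ) * (x : ℂ) ^ (1 - m) / (2 * (Real.pi : ℂ))) *
      ∫ θ in (0 : ℝ)..Real.pi, integrand m x y ξ η θ

end

end Weinstein

namespace Weinstein

open scoped Distributions ContDiff Manifold
open MeasureTheory Set Filter Topology

noncomputable section

/-! Suppose first that `m` is a positive integer. On functions of `(|X|, y)` with `X ∈ ℝ^(m+1)`, the
operator `L_m` is the Laplacian of `ℝ^(m+2)`. The bracket is the squared distance between two points
whose `X`-components make the angle `θ`, and `bracket ^ (-m/2)` is Newton's potential up to a
constant. Averaging over rotations, with weight `sin θ ^ (m-1)`, gives the kernel. The proof is this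
computation made formal, so that `m` may be any complex number with `Re m ≥ 1`.

Adding `ε²` to the bracket makes the potential smooth. With `u` the regularized bracket, `L_m
u^(-m/2)` plus `x⁻²` times an angular Laplacian equals `-m(m+2) ε² u^(-m/2-2)`
(`integral_adjointTest_mul_regBracket`). The angular term, weighted by `sin θ ^ (m-1)`, is an exact
`θ`-derivative and integrates to zero (`integral_angularTerm`).

As `ε → 0` the left side converges to the kernel tested against the adjoint operator, by a bound
uniform in `ε` (`norm_kernelIntegrand_le`). The right side concentrates at `q = a`, `θ = 0`.
Dilating by `ε` there turns it into a convergent integral (`tendsto_integral_scaledIntegrand`) whose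
limit is explicit (`integral_profile`). The result is `L_m K(a, ·) = a₁^(-m) δ_a`
(`weinstein_kernel`).

The statements on `E_m` follow from the symmetry of `K` and two conjugations: `L_m^⋆ x^m = x^m L_m`
passes to the adjoint, and `L_m x^(1-m) = x^(1-m) L_{2-m}` carries `Re m < 1` to `Re m > 1`. -/

variable {Ω : TopologicalSpace.Opens (ℝ × ℝ)}

/-! ### Products of distributions with smooth functions -/

theorem mulTestCLM_apply (g : ℝ × ℝ → ℂ) (hg : ContDiffOn ℝ ∞ g Ω) (φ : 𝓓(Ω, ℂ)) (p : ℝ × ℝ) :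
    mulTestCLM g hg φ p = φ p * g p := rfl

theorem testFunction_eq_zero (φ : 𝓓(Ω, ℂ)) {p : ℝ × ℝ} (hp : p ∉ Ω) : φ p = 0 :=
  image_eq_zero_of_notMem_tsupport fun h => hp (φ.tsupport_subset h)

theorem testFunction_ext {φ ψ : 𝓓(Ω, ℂ)} (h : ∀ p ∈ Ω, φ p = ψ p) : φ = ψ := by
  ext p
  by_cases hp : p ∈ Ω
  · exact h p hp
  · rw [testFunction_eq_zero φ hp, testFunction_eq_zero ψ hp]

theorem hasLineDerivAt_testFunction (v : ℝ × ℝ) (φ : 𝓓(Ω, ℂ)) (p : ℝ × ℝ) :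
    HasLineDerivAt ℝ φ ((TestFunction.lineDerivCLM ℂ v φ : 𝓓(Ω, ℂ)) p) p v := by
  rw [TestFunction.lineDerivCLM_apply_of_le (by simp)]
  have h : Differentiable ℝ φ := φ.contDiff.differentiable (by simp)
  exact (h p).lineDifferentiableAt.hasLineDerivAt

/-- The Leibniz rule for the product of a distribution with a smooth function. -/
theorem deriv_smulDistr (v : ℝ × ℝ) {g g' : ℝ × ℝ → ℂ} (hg : ContDiffOn ℝ ∞ g Ω)
    (hg' : ContDiffOn ℝ ∞ g' Ω) (h : ∀ p ∈ Ω, HasLineDerivAt ℝ g (g' p) p v) (T : Distr Ω) :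
    deriv v (smulDistr g hg T) = smulDistr g hg (deriv v T) + smulDistr g' hg' T := by
  ext φ
  have key : (TestFunction.lineDerivCLM ℂ v (mulTestCLM g hg φ) : 𝓓(Ω, ℂ)) =
      mulTestCLM g hg (TestFunction.lineDerivCLM ℂ v φ : 𝓓(Ω, ℂ)) + mulTestCLM g' hg' φ := by
    refine testFunction_ext fun p hp => ?_
    have h1 := hasLineDerivAt_testFunction v (mulTestCLM g hg φ) p
    have h2 : HasLineDerivAt ℝ (mulTestCLM g hg φ) _ p v :=
      HasDerivAt.mul (hasLineDerivAt_testFunction v φ p) (h p hp)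
    rw [h1.unique h2]
    simp [mulTestCLM_apply]
  change -T (mulTestCLM g hg (TestFunction.lineDerivCLM ℂ v φ)) =
    -T (TestFunction.lineDerivCLM ℂ v (mulTestCLM g hg φ)) + T (mulTestCLM g' hg' φ)
  rw [key, map_add]
  ring

/-- Local integrability is carried along with the identity because `ofFun` takes the default value
`0` without it. -/
theorem smulDistr_ofFun {g f : ℝ × ℝ → ℂ} (hg : ContDiffOn ℝ ∞ g Ω)
    (hf : LocallyIntegrableOn f Ω) : LocallyIntegrableOn (fun p => g p * f p) Ω ∧
    smulDistr g hg (ofFun f : Distr Ω) = ofFun fun p => g p * f p := by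
  have h : LocallyIntegrableOn (fun p => g p * f p) Ω :=
    hf.continuousOn_mul hg.continuousOn Ω.isOpen.isLocallyClosed
  refine ⟨h, ?_⟩
  ext φ
  change (ofFun f : Distr Ω) (mulTestCLM g hg φ) = _
  unfold ofFun
  rw [TestFunction.integralAgainstBilinCLM_eq_integral hf,
    TestFunction.integralAgainstBilinCLM_eq_integral h]
  refine integral_congr_ae (.of_forall fun p => ?_)
  simp only [ContinuousLinearMap.mul_apply', mulTestCLM_apply]
  ring

theorem smulDistr_dirac {g : ℝ × ℝ → ℂ} (hg : ContDiffOn ℝ ∞ g Ω) (a : ℝ × ℝ) :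
    smulDistr g hg (dirac a : Distr Ω) = g a • dirac a := by
  ext φ
  exact mul_comm _ _

/-! ### Conjugation of the Weinstein operators by powers of `x` -/

theorem contDiffOn_cpow (c : ℂ) :
    ContDiffOn ℝ ∞ (fun p : ℝ × ℝ => (p.1 : ℂ) ^ c) halfPlane := by
  have h : ContDiffOn ℝ ∞ (fun p : ℝ × ℝ => Complex.exp ((Real.log p.1 : ℂ) * c)) halfPlane := by
    refine Complex.contDiff_exp.comp_contDiffOn (ContDiffOn.mul ?_ contDiffOn_const)
    exact Complex.ofRealCLM.contDiff.comp_contDiffOn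
      (contDiffOn_fst.log fun p hp => ne_of_gt hp)
  refine h.congr fun p hp => ?_
  have hp' : 0 < p.1 := hp
  rw [Complex.cpow_def_of_ne_zero (Complex.ofReal_ne_zero.2 hp'.ne'),
    Complex.ofReal_log hp'.le]

theorem hasLineDerivAt_cpow (c : ℂ) (v : ℝ × ℝ) {p : ℝ × ℝ} (hp : p ∈ halfPlane) :
    HasLineDerivAt ℝ (fun p : ℝ × ℝ => (p.1 : ℂ) ^ c) (v.1 * (c * (p.1 : ℂ) ^ (c - 1))) p v := by
  have h1 : HasDerivAt (fun t : ℝ => ((p + t • v).1 : ℂ)) (v.1 : ℂ) 0 := by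
    simpa using (((hasDerivAt_id (0 : ℝ)).mul_const v.1).const_add p.1).ofReal_comp
  have hp' : 0 < p.1 := hp
  have h2 : HasDerivAt (fun z : ℂ => z ^ c) (c * (p.1 : ℂ) ^ (c - 1)) (p.1 : ℂ) := by
    simpa using (hasDerivAt_id (p.1 : ℂ)).cpow_const (c := c) (by simp [hp'])
  exact h2.scomp_of_eq 0 h1 (by simp)

/-- The product `x ^ c T` of a distribution on the half-plane with a power of the first
coordinate. -/
def powMul (c : ℂ) (T : Distr halfPlane) : Distr halfPlane :=
  smulDistr (fun p => (p.1 : ℂ) ^ c) (contDiffOn_cpow c) T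

theorem powMul_add (c : ℂ) (S T : Distr halfPlane) :
    powMul c (S + T) = powMul c S + powMul c T := rfl

theorem powMul_smul (c k : ℂ) (T : Distr halfPlane) :
    powMul c (k • T) = k • powMul c T := rfl

theorem powMul_powMul (c d : ℂ) (T : Distr halfPlane) :
    powMul c (powMul d T) = powMul (c + d) T := by
  ext φ
  refine congrArg T (testFunction_ext fun p hp => ?_)
  have hp' : 0 < p.1 := hp
  change φ p * (p.1 : ℂ) ^ c * (p.1 : ℂ) ^ d = φ p * (p.1 : ℂ) ^ (c + d)
  rw [Complex.cpow_add _ _ (Complex.ofReal_ne_zero.2 hp'.ne')]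
  ring

theorem smulDistr_coeff (m : ℂ) (T : Distr halfPlane) :
    smulDistr (fun p => m / (p.1 : ℂ)) (contDiffOn_coeff m) T = m • powMul (-1) T := by
  ext φ
  change T _ = m • T _
  rw [← map_smul]
  refine congrArg T (testFunction_ext fun p hp => ?_)
  change φ p * (m / (p.1 : ℂ)) = m * (φ p * (p.1 : ℂ) ^ (-1 : ℂ))
  rw [Complex.cpow_neg_one]
  ring

theorem partial₁_add (S T : Distr Ω) : partial₁ (S + T) = partial₁ S + partial₁ T := by
  ext φ; simp [partial₁, deriv]; ring

theorem partial₁_smul (k : ℂ) (T : Distr Ω) : partial₁ (k • T) = k • partial₁ T := by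
  ext φ; simp [partial₁, deriv]

theorem partial₁_powMul (c : ℂ) (T : Distr halfPlane) :
    partial₁ (powMul c T) = powMul c (partial₁ T) + c • powMul (c - 1) T := by
  unfold partial₁ powMul
  rw [deriv_smulDistr (1, 0) (contDiffOn_cpow c) (contDiffOn_const.mul (contDiffOn_cpow (c - 1)))
    fun p hp => by simpa using hasLineDerivAt_cpow c (1, 0) hp]
  congr 1
  ext φ
  change T _ = c • T _
  rw [← map_smul]
  refine congrArg T (testFunction_ext fun p hp => ?_)
  change φ p * _ = c * (φ p * _)
  ring

theorem partial₂_powMul (c : ℂ) (T : Distr halfPlane) :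
    partial₂ (powMul c T) = powMul c (partial₂ T) := by
  unfold partial₂ powMul
  rw [deriv_smulDistr (0, 1) (contDiffOn_cpow c) (g' := fun _ => 0) contDiffOn_const
    fun p hp => by simpa using hasLineDerivAt_cpow c (0, 1) hp]
  rw [add_eq_left]
  ext φ
  refine (congrArg T (testFunction_ext fun p hp => ?_)).trans (map_zero T)
  exact mul_zero (φ p)

/-- `L_m^⋆ (x ^ m T) = x ^ m L_m T`. -/
theorem weinsteinAdjoint_powMul (m : ℂ) (T : Distr halfPlane) :
    weinsteinAdjoint m (powMul m T) = powMul m (weinstein m T) := by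
  -- The Leibniz rule brings both sides to combinations of `x ^ c` times derivatives of `T`; only
  -- coefficients remain to be compared.
  simp only [weinstein, weinsteinAdjoint, smulDistr_coeff, partial₁_powMul, partial₂_powMul,
    partial₁_add, partial₁_smul, powMul_add, powMul_smul, powMul_powMul]
  ring_nf
  module

/-- `L_m (x ^ (1 - m) T) = x ^ (1 - m) L_{2-m} T`. -/
theorem weinstein_powMul (m : ℂ) (T : Distr halfPlane) :
    weinstein m (powMul (1 - m) T) = powMul (1 - m) (weinstein (2 - m) T) := by
  simp only [weinstein, smulDistr_coeff, partial₁_powMul, partial₂_powMul,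
    partial₁_add, partial₁_smul, powMul_add, powMul_smul, powMul_powMul]
  ring_nf
  module

/-! ### The regularized kernel and its uniform bound -/

/-- `bracket + ε²`, as a function of the base point `a`, the variable point `q` and the angle. -/
def regBracket (a : ℝ × ℝ) (ε : ℝ) (q : ℝ × ℝ) (θ : ℝ) : ℝ :=
  bracket a.1 a.2 q.1 q.2 θ + ε ^ 2

/-- The integrand of the kernel, regularized by `ε`. -/
def kernelIntegrand (m : ℂ) (a : ℝ × ℝ) (ε : ℝ) (q : ℝ × ℝ) (θ : ℝ) : ℂ :=
  (Real.sin θ : ℂ) ^ (m - 1) * (regBracket a ε q θ : ℂ) ^ (-(m / 2))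

/-- Lebesgue measure on the range of angles. -/
abbrev angleMeasure : Measure ℝ := volume.restrict (Ioo 0 Real.pi)

/-- The symmetric part of the fundamental solution, for `1 ≤ Re m`. -/
def kernel (m : ℂ) (a q : ℝ × ℝ) : ℂ :=
  -(1 / (2 * (Real.pi : ℂ))) * ∫ θ, kernelIntegrand m a 0 q θ ∂angleMeasure

theorem four_mul_sin_half_sq (θ : ℝ) : 4 * Real.sin (θ / 2) ^ 2 = 2 - 2 * Real.cos θ := by
  have h := Real.cos_sq' (θ / 2)
  have h' := Real.cos_two_mul (θ / 2)
  rw [mul_div_cancel₀ θ two_ne_zero] at h'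
  linarith

theorem regBracket_eq_cos (a : ℝ × ℝ) (ε : ℝ) (q : ℝ × ℝ) (θ : ℝ) :
    regBracket a ε q θ = (a.1 - q.1) ^ 2 + 2 * a.1 * q.1 * (1 - Real.cos θ) + (a.2 - q.2) ^ 2 +
      ε ^ 2 := by
  have h := four_mul_sin_half_sq θ
  simp only [regBracket, bracket]
  linear_combination a.1 * q.1 * h

/-- The bracket is the squared distance from `(a₁, 0, a₂)` to `(q₁ cos θ, q₁ sin θ, q₂)`, which
gives positivity for every `q` and the lower bound `(q₁ sin θ)²`. -/
theorem regBracket_eq_sum_sq (a : ℝ × ℝ) (ε : ℝ) (q : ℝ × ℝ) (θ : ℝ) :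
    regBracket a ε q θ = (a.1 - q.1 * Real.cos θ) ^ 2 + (q.1 * Real.sin θ) ^ 2 +
      (a.2 - q.2) ^ 2 + ε ^ 2 := by
  rw [regBracket_eq_cos]
  linear_combination -q.1 ^ 2 * Real.sin_sq_add_cos_sq θ

theorem sq_le_regBracket (a : ℝ × ℝ) (ε : ℝ) (q : ℝ × ℝ) (θ : ℝ) :
    ε ^ 2 ≤ regBracket a ε q θ := by
  rw [regBracket_eq_sum_sq]
  nlinarith [sq_nonneg (a.1 - q.1 * Real.cos θ), sq_nonneg (q.1 * Real.sin θ),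
    sq_nonneg (a.2 - q.2)]

theorem regBracket_pos (a : ℝ × ℝ) {ε : ℝ} (hε : 0 < ε) (q : ℝ × ℝ) (θ : ℝ) :
    0 < regBracket a ε q θ :=
  (pow_pos hε 2).trans_le (sq_le_regBracket a ε q θ)

theorem mul_sin_sq_le_regBracket (a : ℝ × ℝ) (ε : ℝ) (q : ℝ × ℝ) (θ : ℝ) :
    (q.1 * Real.sin θ) ^ 2 ≤ regBracket a ε q θ := by
  rw [regBracket_eq_sum_sq]
  nlinarith [sq_nonneg (a.1 - q.1 * Real.cos θ), sq_nonneg ε, sq_nonneg (a.2 - q.2)]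

theorem norm_sq_le_regBracket {a q : ℝ × ℝ} (ha : 0 < a.1) (hq : 0 < q.1) (ε θ : ℝ) :
    ‖q - a‖ ^ 2 ≤ regBracket a ε q θ := by
  have h : 0 ≤ 4 * a.1 * q.1 * Real.sin (θ / 2) ^ 2 := by positivity
  have h1 : (q.1 - a.1) ^ 2 ≤ regBracket a ε q θ := by
    simp only [regBracket, bracket]
    nlinarith [sq_nonneg ε, sq_nonneg (a.2 - q.2)]
  have h2 : (q.2 - a.2) ^ 2 ≤ regBracket a ε q θ := by
    simp only [regBracket, bracket]
    nlinarith [sq_nonneg ε, sq_nonneg (a.1 - q.1)]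
  rw [Prod.norm_def]
  rcases max_choice ‖(q - a).1‖ ‖(q - a).2‖ with h | h <;> rw [h]
  · simpa using h1
  · simpa using h2

theorem regBracket_pos_of_ne {a q : ℝ × ℝ} (ha : 0 < a.1) (hq : 0 < q.1) (hqa : q ≠ a)
    (ε θ : ℝ) : 0 < regBracket a ε q θ :=
  (pow_pos (norm_pos_iff.2 (sub_ne_zero.2 hqa)) 2).trans_le (norm_sq_le_regBracket ha hq ε θ)

/-- The exponent `-Re m / 2` is split as `-(Re m - 1)/2 - 1/2`. The first part absorbs `sin θ ^ (Re
m - 1)` through `u ≥ (q₁ sin θ)²`, and the second gives `‖q - a‖⁻¹` through `u ≥ ‖q - a‖²`. The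
bound depends neither on `ε` nor on `θ`, so it serves convergence, local integrability and the limit
`ε → 0` alike. -/
theorem norm_kernelIntegrand_le {m : ℂ} (hm : 1 ≤ m.re) {a q : ℝ × ℝ} (ha : 0 < a.1)
    (hq : 0 < q.1) (hqa : q ≠ a) (ε : ℝ) {θ : ℝ} (hθ : θ ∈ Ioo 0 Real.pi) :
    ‖kernelIntegrand m a ε q θ‖ ≤ q.1 ^ (1 - m.re) * ‖q - a‖⁻¹ := by
  have hs : 0 < Real.sin θ := Real.sin_pos_of_mem_Ioo hθ
  have hu := regBracket_pos_of_ne ha hq hqa ε θ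
  have hn : 0 < ‖q - a‖ := norm_pos_iff.2 (sub_ne_zero.2 hqa)
  rw [kernelIntegrand, norm_mul, Complex.norm_cpow_eq_rpow_re_of_pos hs,
    Complex.norm_cpow_eq_rpow_re_of_pos hu]
  have e1 : (m - 1).re = m.re - 1 := by simp
  have e2 : (-(m / 2)).re = -((m.re - 1) / 2) + -(1 / 2) := by
    have : (m / 2).re = m.re / 2 := by simp
    rw [Complex.neg_re, this]; ring
  have h1 : (q.1 * Real.sin θ) ^ (m.re - 1) ≤ regBracket a ε q θ ^ ((m.re - 1) / 2) := by
    calc (q.1 * Real.sin θ) ^ (m.re - 1) = ((q.1 * Real.sin θ) ^ 2) ^ ((m.re - 1) / 2) := by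
          rw [← Real.rpow_natCast_mul (by positivity)]
          congr 1; push_cast; ring
      _ ≤ _ := Real.rpow_le_rpow (by positivity) (mul_sin_sq_le_regBracket a ε q θ) (by linarith)
  have h2 : regBracket a ε q θ ^ (-(1 / 2) : ℝ) ≤ ‖q - a‖⁻¹ := by
    calc regBracket a ε q θ ^ (-(1 / 2) : ℝ) ≤ (‖q - a‖ ^ 2) ^ (-(1 / 2) : ℝ) :=
          Real.rpow_le_rpow_of_nonpos (by positivity) (norm_sq_le_regBracket ha hq ε θ)
            (by norm_num)
      _ = _ := by
          rw [← Real.rpow_natCast_mul (by positivity), ← Real.rpow_neg_one]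
          congr 1; push_cast; ring
  rw [e1, e2, Real.rpow_add hu]
  have h3 : Real.sin θ ^ (m.re - 1) = q.1 ^ (1 - m.re) * (q.1 * Real.sin θ) ^ (m.re - 1) := by
    rw [Real.mul_rpow hq.le hs.le, ← mul_assoc, ← Real.rpow_add hq]
    simp
  have h4 : regBracket a ε q θ ^ ((m.re - 1) / 2) * regBracket a ε q θ ^ (-((m.re - 1) / 2)) = 1 := by
    rw [← Real.rpow_add hu]; simp
  rw [h3]
  calc _ = q.1 ^ (1 - m.re) * (((q.1 * Real.sin θ) ^ (m.re - 1) *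
        regBracket a ε q θ ^ (-((m.re - 1) / 2))) * regBracket a ε q θ ^ (-(1 / 2) : ℝ)) := by ring
    _ ≤ q.1 ^ (1 - m.re) * ((regBracket a ε q θ ^ ((m.re - 1) / 2) *
        regBracket a ε q θ ^ (-((m.re - 1) / 2))) * ‖q - a‖⁻¹) := by gcongr
    _ = _ := by rw [h4, one_mul]

theorem measurable_kernelIntegrand (m : ℂ) (a : ℝ × ℝ) (ε : ℝ) :
    Measurable fun z : (ℝ × ℝ) × ℝ => kernelIntegrand m a ε z.1 z.2 := by
  unfold kernelIntegrand regBracket bracket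
  fun_prop

/-- The order `1` of the singularity is below the dimension `2`. -/
theorem locallyIntegrable_inv_norm_sub (a : ℝ × ℝ) :
    LocallyIntegrable (fun q : ℝ × ℝ => ‖q - a‖⁻¹) := by
  have h : LocallyIntegrable (fun q : ℝ × ℝ => ‖q‖⁻¹) := by
    refine locallyIntegrable_of_norm_le_rpow (C := 1) (α := 1) (by simp) (by simp)
      (.of_forall fun q => ?_) (by fun_prop)
    simp [Real.rpow_neg_one]
  rw [locallyIntegrable_iff] at h ⊢
  intro K hK
  have h' := h (_) (hK.image (f := fun q => q - a) (by fun_prop))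
  have hp := measurePreserving_sub_right (volume : Measure (ℝ × ℝ)) a
  have := (hp.integrableOn_image (MeasurableEquiv.subRight a).measurableEmbedding
    (f := fun q => ‖q‖⁻¹) (s := K)).1 h'
  exact this

theorem locallyIntegrableOn_bound (c : ℝ) (a : ℝ × ℝ) :
    LocallyIntegrableOn (fun q : ℝ × ℝ => q.1 ^ c * ‖q - a‖⁻¹) halfPlane := by
  refine ((locallyIntegrable_inv_norm_sub a).locallyIntegrableOn _).continuousOn_mul ?_
    halfPlane.isOpen.isLocallyClosed
  exact continuousOn_fst.rpow_const fun q hq => Or.inl (ne_of_gt hq)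

theorem ae_prod_angleMeasure {μ : Measure (ℝ × ℝ)} [SFinite μ] {P : ℝ × ℝ → Prop}
    (hP : ∀ᵐ q ∂μ, P q) :
    ∀ᵐ z ∂(μ.prod angleMeasure), P z.1 ∧ z.2 ∈ Ioo 0 Real.pi := by
  have h1 : ∀ᵐ z ∂(μ.prod angleMeasure), P z.1 := Measure.quasiMeasurePreserving_fst.ae hP
  have h2 : ∀ᵐ z ∂(μ.prod angleMeasure), z.2 ∈ Ioo 0 Real.pi :=
    Measure.quasiMeasurePreserving_snd.ae (ae_restrict_mem measurableSet_Ioo)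
  filter_upwards [h1, h2] with z hz1 hz2 using ⟨hz1, hz2⟩

theorem integrable_kernelIntegrand {m : ℂ} (hm : 1 ≤ m.re) {a : ℝ × ℝ} (ha : 0 < a.1)
    {K : Set (ℝ × ℝ)} (hK : IsCompact K) (hKΩ : K ⊆ halfPlane) (ε : ℝ) :
    Integrable (fun z : (ℝ × ℝ) × ℝ => kernelIntegrand m a ε z.1 z.2)
      ((volume.restrict K).prod angleMeasure) := by
  have h := (locallyIntegrableOn_bound (1 - m.re) a).integrableOn_compact_subset hKΩ hK
  refine (h.comp_fst angleMeasure).mono' (measurable_kernelIntegrand m a ε).aestronglyMeasurable ?_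
  have hP : ∀ᵐ q ∂(volume.restrict K), q ∈ K ∧ q ≠ a :=
    (ae_restrict_mem hK.measurableSet).and (ae_restrict_of_ae (Measure.ae_ne volume a))
  filter_upwards [ae_prod_angleMeasure hP] with z hz
  exact norm_kernelIntegrand_le hm ha (hKΩ hz.1.1) hz.1.2 ε hz.2

theorem locallyIntegrableOn_kernel {m : ℂ} (hm : 1 ≤ m.re) {a : ℝ × ℝ} (ha : 0 < a.1) :
    LocallyIntegrableOn (kernel m a) halfPlane := by
  rw [locallyIntegrableOn_iff halfPlane.isOpen.isLocallyClosed]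
  intro K hKΩ hK
  exact (integrable_kernelIntegrand hm ha hK hKΩ 0).integral_prod_left.const_mul _

/-! ### Integration by parts against the regularized potential -/

/-- The formal adjoint of the Weinstein operator on test functions. -/
def adjointTest (m : ℂ) (ψ : 𝓓(halfPlane, ℂ)) : 𝓓(halfPlane, ℂ) :=
  TestFunction.lineDerivCLM ℂ (1, 0) (TestFunction.lineDerivCLM ℂ (1, 0) ψ : 𝓓(halfPlane, ℂ)) +
  TestFunction.lineDerivCLM ℂ (0, 1) (TestFunction.lineDerivCLM ℂ (0, 1) ψ : 𝓓(halfPlane, ℂ)) -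
  TestFunction.lineDerivCLM ℂ (1, 0) (mulTestCLM _ (contDiffOn_coeff m) ψ)

theorem weinstein_apply (m : ℂ) (T : Distr halfPlane) (ψ : 𝓓(halfPlane, ℂ)) :
    weinstein m T ψ = T (adjointTest m ψ) := by
  rw [adjointTest, map_sub, map_add]
  simp [weinstein, partial₁, partial₂, deriv, smulDistr, sub_eq_add_neg]

theorem integrable_testFunction_mul {Ω : TopologicalSpace.Opens (ℝ × ℝ)} (φ : 𝓓(Ω, ℂ))
    {g : ℝ × ℝ → ℂ} (hg : Continuous g) : Integrable (fun q => φ q * g q) :=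
  (φ.continuous.mul hg).integrable_of_hasCompactSupport φ.hasCompactSupport.mul_right

/-- Integration by parts against a test function. -/
theorem integral_lineDeriv_mul {Ω : TopologicalSpace.Opens (ℝ × ℝ)} (v : ℝ × ℝ) (φ : 𝓓(Ω, ℂ))
    {g g' : ℝ × ℝ → ℂ} (hg : Continuous g) (hg' : Continuous g')
    (h : ∀ q, HasLineDerivAt ℝ g (g' q) q v) :
    ∫ q, (TestFunction.lineDerivCLM ℂ v φ : 𝓓(Ω, ℂ)) q * g q = -∫ q, φ q * g' q := by
  have := integral_bilinear_hasLineDerivAt_right_eq_neg_left_of_integrable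
    (μ := (volume : Measure (ℝ × ℝ))) (B := ContinuousLinearMap.mul ℝ ℂ) (f := φ) (g := g)
    (f' := (TestFunction.lineDerivCLM ℂ v φ : 𝓓(Ω, ℂ))) (g' := g') (v := v)
    (integrable_testFunction_mul _ hg) (integrable_testFunction_mul _ hg')
    (integrable_testFunction_mul _ hg) (fun q _ => hasLineDerivAt_testFunction v φ q)
    (fun q _ => h q)
  simp only [ContinuousLinearMap.mul_apply'] at this
  rw [this, neg_neg]

theorem continuous_regBracket (a : ℝ × ℝ) (ε : ℝ) :
    Continuous fun z : (ℝ × ℝ) × ℝ => regBracket a ε z.1 z.2 := by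
  unfold regBracket bracket
  fun_prop

theorem continuous_regBracket_cpow (a : ℝ × ℝ) {ε : ℝ} (hε : 0 < ε) (c : ℂ) :
    Continuous fun z : (ℝ × ℝ) × ℝ => (regBracket a ε z.1 z.2 : ℂ) ^ c :=
  (Complex.continuous_ofReal.comp (continuous_regBracket a ε)).cpow continuous_const
    fun z => by simp [regBracket_pos a hε]

theorem continuous_regBracket_cpow_left (a : ℝ × ℝ) {ε : ℝ} (hε : 0 < ε) (c : ℂ) (θ : ℝ) :
    Continuous fun q : ℝ × ℝ => (regBracket a ε q θ : ℂ) ^ c :=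
  (continuous_regBracket_cpow a hε c).comp (Continuous.prodMk_left θ)

/-- Half the derivative of `regBracket` in the direction `v`. -/
def slope (a : ℝ × ℝ) (v q : ℝ × ℝ) (θ : ℝ) : ℝ :=
  (q.1 - a.1 * Real.cos θ) * v.1 + (q.2 - a.2) * v.2

theorem hasDerivAt_ofReal_cpow {f : ℝ → ℝ} {f' t : ℝ} (hf : HasDerivAt f f' t) (h : 0 < f t)
    (c : ℂ) : HasDerivAt (fun t => (f t : ℂ) ^ c) (f' * (c * (f t : ℂ) ^ (c - 1))) t := by
  have h2 : HasDerivAt (fun z : ℂ => z ^ c) (c * (f t : ℂ) ^ (c - 1)) (f t : ℂ) := by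
    simpa using (hasDerivAt_id (f t : ℂ)).cpow_const (c := c) (by simp [h])
  exact h2.scomp t hf.ofReal_comp

/-- Along a line the bracket is exactly quadratic in `t`, so the derivative is its linear
coefficient. -/
theorem hasDerivAt_regBracket_line (a : ℝ × ℝ) (ε : ℝ) (v q : ℝ × ℝ) (θ : ℝ) :
    HasDerivAt (fun t : ℝ => regBracket a ε (q + t • v) θ) (2 * slope a v q θ) 0 := by
  have e : (fun t : ℝ => regBracket a ε (q + t • v) θ) = fun t : ℝ =>
      regBracket a ε q θ + 2 * slope a v q θ * t + (v.1 ^ 2 + v.2 ^ 2) * t ^ 2 := by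
    funext t
    simp only [regBracket_eq_cos, slope, Prod.fst_add, Prod.snd_add, Prod.smul_fst, Prod.smul_snd,
      smul_eq_mul]
    ring
  rw [e]
  have h1 := ((hasDerivAt_id (0 : ℝ)).const_mul (2 * slope a v q θ)).const_add
    (regBracket a ε q θ)
  have h2 := ((hasDerivAt_id (0 : ℝ)).pow 2).const_mul (v.1 ^ 2 + v.2 ^ 2)
  exact (h1.add h2).congr_deriv (by simp)

theorem hasLineDerivAt_regBracket_cpow (a : ℝ × ℝ) {ε : ℝ} (hε : 0 < ε) (c : ℂ) (v q : ℝ × ℝ)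
    (θ : ℝ) : HasLineDerivAt ℝ (fun q => (regBracket a ε q θ : ℂ) ^ c)
      (2 * c * (slope a v q θ * (regBracket a ε q θ : ℂ) ^ (c - 1))) q v := by
  have h := hasDerivAt_ofReal_cpow (hasDerivAt_regBracket_line a ε v q θ)
    (regBracket_pos a hε _ _) c
  simp only [zero_smul, add_zero] at h
  exact h.congr_deriv (by push_cast; ring)

theorem hasLineDerivAt_slope (a v q : ℝ × ℝ) (θ : ℝ) :
    HasLineDerivAt ℝ (fun q => (slope a v q θ : ℂ)) ((v.1 ^ 2 + v.2 ^ 2 : ℝ) : ℂ) q v := by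
  unfold HasLineDerivAt
  have e : (fun t : ℝ => (slope a v (q + t • v) θ : ℂ)) = fun t : ℝ =>
      ((slope a v q θ + (v.1 ^ 2 + v.2 ^ 2) * t : ℝ) : ℂ) := by
    funext t
    simp only [slope, Prod.fst_add, Prod.snd_add, Prod.smul_fst, Prod.smul_snd, smul_eq_mul]
    push_cast
    ring
  rw [e]
  exact ((((hasDerivAt_id (0 : ℝ)).const_mul (v.1 ^ 2 + v.2 ^ 2)).const_add
    (slope a v q θ)).ofReal_comp).congr_deriv (by simp)

theorem continuous_slope (a v : ℝ × ℝ) (θ : ℝ) : Continuous fun q => (slope a v q θ : ℂ) := by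
  unfold slope
  fun_prop

theorem integral_lineDeriv_mul_regBracket (a : ℝ × ℝ) {ε : ℝ} (hε : 0 < ε) (c : ℂ) (v : ℝ × ℝ)
    (θ : ℝ) (φ : 𝓓(halfPlane, ℂ)) :
    ∫ q, (TestFunction.lineDerivCLM ℂ v φ : 𝓓(halfPlane, ℂ)) q * (regBracket a ε q θ : ℂ) ^ c =
      -∫ q, φ q * (2 * c * (slope a v q θ * (regBracket a ε q θ : ℂ) ^ (c - 1))) :=
  integral_lineDeriv_mul v φ (continuous_regBracket_cpow_left a hε c θ)
    (continuous_const.mul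
      ((continuous_slope a v θ).mul (continuous_regBracket_cpow_left a hε _ θ)))
    fun q => hasLineDerivAt_regBracket_cpow a hε c v q θ

theorem integral_lineDeriv_lineDeriv_mul_regBracket (a : ℝ × ℝ) {ε : ℝ} (hε : 0 < ε) (c : ℂ)
    (v : ℝ × ℝ) (θ : ℝ) (φ : 𝓓(halfPlane, ℂ)) :
    ∫ q, (TestFunction.lineDerivCLM ℂ v
        (TestFunction.lineDerivCLM ℂ v φ : 𝓓(halfPlane, ℂ)) : 𝓓(halfPlane, ℂ)) q *
        (regBracket a ε q θ : ℂ) ^ c =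
      ∫ q, φ q * (2 * c * ((v.1 ^ 2 + v.2 ^ 2 : ℝ) * (regBracket a ε q θ : ℂ) ^ (c - 1) +
        slope a v q θ * (2 * (c - 1) * (slope a v q θ *
          (regBracket a ε q θ : ℂ) ^ (c - 1 - 1))))) := by
  rw [integral_lineDeriv_mul_regBracket a hε, neg_eq_iff_eq_neg]
  have h1 := continuous_slope a v θ
  have h2 := fun c => continuous_regBracket_cpow_left a hε c θ
  refine integral_lineDeriv_mul v φ (continuous_const.mul (h1.mul (h2 _))) ?_ fun q => ?_
  · exact continuous_const.mul ((continuous_const.mul (h2 _)).add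
      (h1.mul (continuous_const.mul (h1.mul (h2 _)))))
  · exact ((HasDerivAt.mul (hasLineDerivAt_slope a v q θ)
      (hasLineDerivAt_regBracket_cpow a hε (c - 1) v q θ)).congr_deriv
        (by simp)).const_mul (2 * c)

/-! ### The equation of the regularized kernel -/

/-- The term of the Laplacian coming from the angular variable, without the factor
`sin θ ^ (m - 1)`. -/
def angularTerm (m : ℂ) (a : ℝ × ℝ) (ε : ℝ) (q : ℝ × ℝ) (θ : ℝ) : ℂ :=
  -(m * a.1 * q.1) * (m * Real.cos θ * (regBracket a ε q θ : ℂ) ^ (-(m / 2) - 1) +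
    2 * a.1 * q.1 * (-(m / 2) - 1) * Real.sin θ ^ 2 *
      (regBracket a ε q θ : ℂ) ^ (-(m / 2) - 1 - 1))

theorem continuous_angularTerm (m : ℂ) (a : ℝ × ℝ) {ε : ℝ} (hε : 0 < ε) :
    Continuous fun z : (ℝ × ℝ) × ℝ => angularTerm m a ε z.1 z.2 := by
  have h := continuous_regBracket_cpow a hε
  have h1 := h (-(m / 2) - 1)
  have h2 := h (-(m / 2) - 1 - 1)
  unfold angularTerm
  fun_prop

/-- This is `Δ (r² + ε²)^(-m/2) = -m(m+2) ε² (r² + ε²)^(-m/2-2)` in dimension `m + 2`, with the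
Laplacian split into `L_m` and `x⁻²` times its angular part. -/
theorem integral_adjointTest_mul_regBracket (m : ℂ) (a : ℝ × ℝ) {ε : ℝ} (hε : 0 < ε) (θ : ℝ)
    (ψ : 𝓓(halfPlane, ℂ)) :
    ∫ q, adjointTest m ψ q * (regBracket a ε q θ : ℂ) ^ (-(m / 2)) =
      ∫ q, (-(m * (m + 2) * ε ^ 2) * (ψ q * (regBracket a ε q θ : ℂ) ^ (-(m / 2) - 2)) -
        mulTestCLM _ (contDiffOn_cpow (-2)) ψ q * angularTerm m a ε q θ) := by
  have h := fun c => continuous_regBracket_cpow_left a hε c θ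
  have hs := fun v => continuous_slope a v θ
  simp only [adjointTest, FunLike.coe_sub, FunLike.coe_add, Pi.add_apply, Pi.sub_apply,
    sub_mul, add_mul]
  rw [integral_sub, integral_add, integral_lineDeriv_lineDeriv_mul_regBracket a hε,
    integral_lineDeriv_lineDeriv_mul_regBracket a hε, integral_lineDeriv_mul_regBracket a hε,
    ← integral_add, sub_neg_eq_add, ← integral_add]
  · refine integral_congr_ae (.of_forall fun q => ?_)
    by_cases hq : q ∈ halfPlane
    swap
    · simp [testFunction_eq_zero _ hq]
    have hq' : 0 < q.1 := hq
    have hq0 : (q.1 : ℂ) ≠ 0 := Complex.ofReal_ne_zero.2 hq'.ne'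
    have hu := regBracket_pos a hε q θ
    have hu0 : (regBracket a ε q θ : ℂ) ≠ 0 := Complex.ofReal_ne_zero.2 hu.ne'
    have e1 : (regBracket a ε q θ : ℂ) ^ (-(m / 2) - 1) =
        regBracket a ε q θ * (regBracket a ε q θ : ℂ) ^ (-(m / 2) - 2) := by
      have : -(m / 2) - 1 = 1 + (-(m / 2) - 2) := by ring
      rw [this, Complex.cpow_add _ _ hu0, Complex.cpow_one]
    have e2 : -(m / 2) - 1 - 1 = -(m / 2) - 2 := by ring
    have e3 : (q.1 : ℂ) ^ (-2 : ℂ) = ((q.1 : ℂ) ^ 2)⁻¹ := by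
      rw [Complex.cpow_neg, Complex.cpow_ofNat]
    have e4 : (regBracket a ε q θ : ℂ) = (a.1 - q.1) ^ 2 + 2 * a.1 * q.1 * (1 - Real.cos θ) +
        (a.2 - q.2) ^ 2 + ε ^ 2 := by
      rw [regBracket_eq_cos]; push_cast; ring
    have e5 : (Real.sin θ : ℂ) ^ 2 = 1 - (Real.cos θ : ℂ) ^ 2 := by
      have := Real.sin_sq θ
      exact_mod_cast congrArg (fun x : ℝ => (x : ℂ)) this
    simp only [mulTestCLM_apply, angularTerm, e2, e1, e3, e5, slope]
    -- All powers of the bracket are now multiples of this one; what remains is a rational identity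
    -- in the coordinates, `cos θ`, `ε` and `m`.
    generalize (regBracket a ε q θ : ℂ) ^ (-(m / 2) - 2) = U
    rw [e4]
    push_cast
    field_simp
    ring
  all_goals
    have h1 := h (-(m / 2) - 1)
    have h2 := h (-(m / 2) - 1 - 1)
    have hs1 := hs (1, 0)
    have hs2 := hs (0, 1)
  · exact (integrable_testFunction_mul ψ (by fun_prop)).add
      (integrable_testFunction_mul ψ (by fun_prop))
  · exact integrable_testFunction_mul _ (by fun_prop)
  · exact integrable_testFunction_mul _ (by fun_prop)
  · exact integrable_testFunction_mul _ (by fun_prop)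
  · exact integrable_testFunction_mul _ (h _)
  · exact integrable_testFunction_mul _ (h _)
  · exact (integrable_testFunction_mul _ (h _)).add (integrable_testFunction_mul _ (h _))
  · exact integrable_testFunction_mul _ (h _)

/-- For `Re m ≥ 1` the weight `sin θ ^ (m-1)` is bounded by `1`, and the rest is continuous with `φ`
compactly supported. This justifies Fubini below. -/
theorem integrable_mul_sin_cpow {m : ℂ} (hm : 1 ≤ m.re) {Ω : TopologicalSpace.Opens (ℝ × ℝ)}
    (φ : 𝓓(Ω, ℂ)) {c : (ℝ × ℝ) × ℝ → ℂ} (hc : Continuous c) :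
    Integrable (fun z : (ℝ × ℝ) × ℝ => φ z.1 * ((Real.sin z.2 : ℂ) ^ (m - 1) * c z))
      (volume.prod angleMeasure) := by
  obtain ⟨C, hC⟩ := (φ.hasCompactSupport.isCompact.prod
    (isCompact_Icc (a := 0) (b := Real.pi))).exists_bound_of_continuousOn hc.continuousOn
  have hφ : Integrable φ := φ.continuous.integrable_of_hasCompactSupport φ.hasCompactSupport
  refine ((hφ.norm.mul_const C).comp_fst angleMeasure).mono' ?_ ?_
  · have h1 : Measurable fun z : (ℝ × ℝ) × ℝ => (Real.sin z.2 : ℂ) ^ (m - 1) := by fun_prop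
    have h2 : Continuous fun z : (ℝ × ℝ) × ℝ => φ z.1 := φ.continuous.comp continuous_fst
    exact (h2.measurable.mul (h1.mul hc.measurable)).aestronglyMeasurable
  · filter_upwards [ae_prod_angleMeasure (.of_forall fun _ => trivial)] with z hz
    by_cases hq : z.1 ∈ tsupport φ
    · have hs : 0 < Real.sin z.2 := Real.sin_pos_of_mem_Ioo hz.2
      rw [norm_mul, norm_mul, Complex.norm_cpow_eq_rpow_re_of_pos hs]
      have h1 : Real.sin z.2 ^ (m - 1).re ≤ 1 :=
        Real.rpow_le_one hs.le (Real.sin_le_one _) (by simpa using hm)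
      have h2 := hC z ⟨hq, Ioo_subset_Icc_self hz.2⟩
      gcongr
      calc _ ≤ 1 * C := by gcongr
        _ = C := one_mul C
    · simp [image_eq_zero_of_notMem_tsupport hq]

theorem integral_angularTerm {m : ℂ} (hm : 1 ≤ m.re) (a : ℝ × ℝ) {ε : ℝ} (hε : 0 < ε)
    (q : ℝ × ℝ) : ∫ θ, (Real.sin θ : ℂ) ^ (m - 1) * angularTerm m a ε q θ ∂angleMeasure = 0 := by
  have hm0 : m ≠ 0 := by rintro rfl; simp at hm; linarith
  have hc : ∀ c : ℂ, Continuous fun θ => (regBracket a ε q θ : ℂ) ^ c := fun c =>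
    (continuous_regBracket_cpow a hε c).comp (Continuous.prodMk_right q)
  have hcω : Continuous fun θ => angularTerm m a ε q θ :=
    (continuous_angularTerm m a hε).comp (Continuous.prodMk_right q)
  rw [← integral_Ioc_eq_integral_Ioo, ← intervalIntegral.integral_of_le Real.pi_pos.le]
  -- The primitive is `sin θ ^ (m-1) ∂_θ u^(-m/2)`, as `∂_θ u = 2 a₁ q₁ sin θ`.
  have hd : ∀ θ ∈ Ioo 0 Real.pi, HasDerivAt (fun θ : ℝ => -(m * a.1 * q.1) *
      ((Real.sin θ : ℂ) ^ m * (regBracket a ε q θ : ℂ) ^ (-(m / 2) - 1)))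
      ((Real.sin θ : ℂ) ^ (m - 1) * angularTerm m a ε q θ) θ := by
    intro θ hθ
    have hs : 0 < Real.sin θ := Real.sin_pos_of_mem_Ioo hθ
    have h1 := hasDerivAt_ofReal_cpow (Real.hasDerivAt_sin θ) hs m
    have h2 : HasDerivAt (fun θ => regBracket a ε q θ) (2 * a.1 * q.1 * Real.sin θ) θ := by
      simp only [regBracket_eq_cos]
      simpa using ((((Real.hasDerivAt_cos θ).const_sub 1).const_mul (2 * a.1 * q.1)).const_add
        ((a.1 - q.1) ^ 2)).add_const ((a.2 - q.2) ^ 2) |>.add_const (ε ^ 2)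
    have h3 := hasDerivAt_ofReal_cpow h2 (regBracket_pos a hε q θ) (-(m / 2) - 1)
    refine ((h1.mul h3).const_mul (-(m * a.1 * q.1))).congr_deriv ?_
    have e : (Real.sin θ : ℂ) ^ m = Real.sin θ * (Real.sin θ : ℂ) ^ (m - 1) := by
      have := Complex.cpow_add 1 (m - 1) (Complex.ofReal_ne_zero.2 hs.ne')
      rwa [Complex.cpow_one, add_sub_cancel] at this
    rw [e, angularTerm]
    push_cast
    ring
  rw [intervalIntegral.integral_eq_sub_of_hasDerivAt_of_le Real.pi_pos.le ?_ hd ?_]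
  -- The factor `sin θ ^ m` vanishes at `0` and `π`, since `0 ^ m = 0` for `m ≠ 0`.
  · simp [hm0]
  · have h1 := (Complex.continuous_ofReal_cpow_const (y := m) (by linarith)).comp
      Real.continuous_sin
    exact (continuous_const.mul (h1.mul (hc _))).continuousOn
  · rw [intervalIntegrable_iff_integrableOn_Ioo_of_le Real.pi_pos.le]
    obtain ⟨C, hC⟩ := (isCompact_Icc (a := 0) (b := Real.pi)).exists_bound_of_continuousOn
      hcω.continuousOn
    refine Integrable.mono' (g := fun _ => C) (integrable_const _) ?_ ?_
    · have h1 : Measurable fun θ : ℝ => (Real.sin θ : ℂ) ^ (m - 1) := by fun_prop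
      exact (h1.mul hcω.measurable).aestronglyMeasurable
    · filter_upwards [ae_restrict_mem measurableSet_Ioo] with θ hθ
      have hs : 0 < Real.sin θ := Real.sin_pos_of_mem_Ioo hθ
      rw [norm_mul, Complex.norm_cpow_eq_rpow_re_of_pos hs]
      have h1 : Real.sin θ ^ (m - 1).re ≤ 1 :=
        Real.rpow_le_one hs.le (Real.sin_le_one _) (by simpa using hm)
      calc _ ≤ 1 * C := by gcongr; exact hC θ (Ioo_subset_Icc_self hθ)
        _ = C := one_mul C

/-- Fubini is used in both orders: integration by parts in `q` at fixed `θ`, and cancellation of the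
angular term in `θ` at fixed `q`. -/
theorem integral_adjointTest_mul_kernelIntegrand {m : ℂ} (hm : 1 ≤ m.re) (a : ℝ × ℝ) {ε : ℝ}
    (hε : 0 < ε) (ψ : 𝓓(halfPlane, ℂ)) :
    ∫ z : (ℝ × ℝ) × ℝ, adjointTest m ψ z.1 * kernelIntegrand m a ε z.1 z.2
        ∂(volume.prod angleMeasure) =
      -(m * (m + 2) * ε ^ 2) * ∫ z : (ℝ × ℝ) × ℝ, ψ z.1 * ((Real.sin z.2 : ℂ) ^ (m - 1) *
        (regBracket a ε z.1 z.2 : ℂ) ^ (-(m / 2) - 2)) ∂(volume.prod angleMeasure) := by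
  have i1 := integrable_mul_sin_cpow hm (adjointTest m ψ)
    (continuous_regBracket_cpow a hε (-(m / 2)))
  have i2 := integrable_mul_sin_cpow hm ψ (continuous_regBracket_cpow a hε (-(m / 2) - 2))
  have i3 := integrable_mul_sin_cpow hm (mulTestCLM _ (contDiffOn_cpow (-2)) ψ)
    (continuous_angularTerm m a hε)
  have h3 : ∫ z : (ℝ × ℝ) × ℝ, mulTestCLM _ (contDiffOn_cpow (-2)) ψ z.1 *
      ((Real.sin z.2 : ℂ) ^ (m - 1) * angularTerm m a ε z.1 z.2)
        ∂(volume.prod angleMeasure) = 0 := by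
    rw [integral_prod _ i3]
    simp only [integral_const_mul, integral_angularTerm hm a hε, mul_zero, integral_zero]
  rw [← integral_const_mul]
  refine Eq.trans ?_ ((integral_sub (i2.const_mul _) i3).trans (by rw [h3, sub_zero]))
  refine (integral_prod_symm _ i1).trans
    (Eq.trans ?_ (integral_prod_symm _ ((i2.const_mul _).sub i3)).symm)
  refine integral_congr_ae (.of_forall fun θ => ?_)
  have h := congrArg (fun I => (Real.sin θ : ℂ) ^ (m - 1) * I)
    (integral_adjointTest_mul_regBracket m a hε θ ψ)
  simp only [← integral_const_mul] at h
  refine (integral_congr_ae (.of_forall fun q => ?_)).trans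
    (h.trans (integral_congr_ae (.of_forall fun q => ?_)))
  · simp only
    ring
  · simp only [Pi.sub_apply]
    ring

/-! ### Explicit integrals for the limiting mass -/

theorem ofReal_sq_cpow {r : ℝ} (hr : 0 < r) (w : ℂ) : ((r ^ 2 : ℝ) : ℂ) ^ w = (r : ℂ) ^ (2 * w) := by
  rw [sq, Complex.ofReal_mul, Complex.mul_cpow_ofReal_nonneg hr.le hr.le, two_mul,
    Complex.cpow_add _ _ (Complex.ofReal_ne_zero.2 hr.ne')]

theorem tendsto_add_sq_rpow_atTop (A : ℝ) {s : ℝ} (hs : s < 0) :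
    Tendsto (fun r : ℝ => (A + r ^ 2) ^ s) atTop (𝓝 0) := by
  have h := (tendsto_rpow_neg_atTop (neg_pos.2 hs)).comp
    (tendsto_atTop_add_const_left _ A (tendsto_pow_atTop (α := ℝ) two_ne_zero))
  rw [neg_neg] at h
  exact h

theorem tendsto_add_sq_cpow_atTop (A : ℝ) {w : ℂ} (hw : w.re < 0) :
    Tendsto (fun r : ℝ => ((A + r ^ 2 : ℝ) : ℂ) ^ w) atTop (𝓝 0) := by
  have h : Tendsto (fun r : ℝ => A + r ^ 2) atTop atTop :=
    tendsto_atTop_add_const_left _ _ (tendsto_pow_atTop two_ne_zero)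
  rw [tendsto_zero_iff_norm_tendsto_zero]
  refine (tendsto_add_sq_rpow_atTop A hw).congr' ?_
  filter_upwards [h.eventually_gt_atTop 0] with r hr
  rw [Complex.norm_cpow_eq_rpow_re_of_pos hr]

theorem hasDerivAt_add_sq_cpow {A : ℝ} (hA : 0 < A) {w : ℂ} (hw : w ≠ 0) (r : ℝ) :
    HasDerivAt (fun r : ℝ => ((A + r ^ 2 : ℝ) : ℂ) ^ w / (2 * w))
      (r * ((A + r ^ 2 : ℝ) : ℂ) ^ (w - 1)) r := by
  have h1 : HasDerivAt (fun r : ℝ => A + r ^ 2) (2 * r) r := by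
    simpa using ((hasDerivAt_id r).pow 2).const_add A
  refine ((hasDerivAt_ofReal_cpow h1 (by positivity) w).div_const (2 * w)).congr_deriv ?_
  push_cast
  field_simp

/-- The norm of the integrand is the derivative of `(A + r²)^(Re w) / (2 Re w)`, a nonnegative
derivative whose primitive has a finite limit. -/
theorem integrableOn_mul_add_sq_cpow {A : ℝ} (hA : 0 < A) {w : ℂ} (hw : w.re < 0) :
    IntegrableOn (fun r : ℝ => (r : ℂ) * ((A + r ^ 2 : ℝ) : ℂ) ^ (w - 1)) (Ioi 0) := by
  have hd : ∀ r ∈ Ici (0 : ℝ), HasDerivAt (fun r : ℝ => (A + r ^ 2) ^ w.re / (2 * w.re))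
      (r * (A + r ^ 2) ^ (w.re - 1)) r := by
    intro r _
    have h1 : HasDerivAt (fun r : ℝ => A + r ^ 2) (2 * r) r := by
      simpa using ((hasDerivAt_id r).pow 2).const_add A
    refine ((h1.rpow_const (p := w.re) (Or.inl (by positivity))).div_const (2 * w.re)).congr_deriv ?_
    field_simp [hw.ne]
  have ht : Tendsto (fun r : ℝ => (A + r ^ 2) ^ w.re / (2 * w.re)) atTop (𝓝 (0 / (2 * w.re))) :=
    (tendsto_add_sq_rpow_atTop A hw).div_const _
  have h := integrableOn_Ioi_deriv_of_nonneg' hd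
    (fun r hr => mul_nonneg (le_of_lt hr) (by positivity)) ht
  refine Integrable.mono' h ?_ ?_
  · exact Measurable.aestronglyMeasurable (by fun_prop)
  · filter_upwards [ae_restrict_mem measurableSet_Ioi] with r hr
    have hr' : 0 < r := hr
    rw [norm_mul, Complex.norm_cpow_eq_rpow_re_of_pos (by positivity), Complex.norm_real,
      Real.norm_of_nonneg hr'.le]
    simp

theorem integral_mul_add_sq_cpow {A : ℝ} (hA : 0 < A) {w : ℂ} (hw : w.re < 0) :
    ∫ r in Ioi (0 : ℝ), (r : ℂ) * ((A + r ^ 2 : ℝ) : ℂ) ^ (w - 1) = -((A : ℂ) ^ w / (2 * w)) := by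
  have hw0 : w ≠ 0 := by rintro rfl; simp at hw
  rw [integral_Ioi_of_hasDerivAt_of_tendsto' (fun r _ => hasDerivAt_add_sq_cpow hA hw0 r)
    (integrableOn_mul_add_sq_cpow hA hw)
    ((tendsto_add_sq_cpow_atTop A hw).div_const (2 * w))]
  simp

theorem integral_add_sq_add_sq_cpow {A : ℝ} (hA : 0 < A) {w : ℂ} (hw : w.re < 0) :
    ∫ q : ℝ × ℝ, ((A + (q.1 ^ 2 + q.2 ^ 2) : ℝ) : ℂ) ^ (w - 1) = -(Real.pi * (A : ℂ) ^ w / w) := by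
  have hw0 : w ≠ 0 := by rintro rfl; simp at hw
  rw [← integral_comp_polarCoord_symm, polarCoord_target]
  have e : ∀ p : ℝ × ℝ, p.1 • ((A + ((polarCoord.symm p).1 ^ 2 + (polarCoord.symm p).2 ^ 2) : ℝ) : ℂ)
      ^ (w - 1) = ((p.1 : ℂ) * ((A + p.1 ^ 2 : ℝ) : ℂ) ^ (w - 1)) * 1 := by
    intro p
    have : (polarCoord.symm p).1 ^ 2 + (polarCoord.symm p).2 ^ 2 = p.1 ^ 2 := by
      simp only [polarCoord_symm_apply]
      linear_combination p.1 ^ 2 * Real.sin_sq_add_cos_sq p.2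
    rw [this, Complex.real_smul, mul_one]
  simp only [e]
  rw [Measure.volume_eq_prod, setIntegral_prod_mul
    (fun r : ℝ => (r : ℂ) * ((A + r ^ 2 : ℝ) : ℂ) ^ (w - 1)) (fun _ : ℝ => (1 : ℂ)),
    integral_mul_add_sq_cpow hA hw]
  simp [Real.pi_pos.le]
  field_simp
  ring

/-- The integrand has the primitive `t^m (1 + k²t²)^(-m/2) / m`, which vanishes at `0`. -/
theorem integral_cpow_mul_one_add_sq_cpow {m : ℂ} (hm : 0 < m.re) {k : ℝ} (hk : 0 < k)
    (hi : IntegrableOn (fun t : ℝ => (t : ℂ) ^ (m - 1) *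
      ((1 + k ^ 2 * t ^ 2 : ℝ) : ℂ) ^ (-(m / 2) - 1)) (Ioi 0)) :
    ∫ t in Ioi (0 : ℝ), (t : ℂ) ^ (m - 1) * ((1 + k ^ 2 * t ^ 2 : ℝ) : ℂ) ^ (-(m / 2) - 1) =
      (k : ℂ) ^ (-m) / m := by
  have hm0 : m ≠ 0 := by rintro rfl; simp at hm
  have hu : ∀ t : ℝ, 0 < 1 + k ^ 2 * t ^ 2 := fun t => by positivity
  have hcont : Continuous fun t : ℝ =>
      (t : ℂ) ^ m * ((1 + k ^ 2 * t ^ 2 : ℝ) : ℂ) ^ (-(m / 2)) / m := by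
    refine Continuous.div_const (Continuous.mul (Complex.continuous_ofReal_cpow_const hm) ?_) _
    refine Continuous.cpow (by fun_prop) continuous_const fun t => ?_
    exact Complex.ofReal_mem_slitPlane.2 (hu t)
  have hd : ∀ t ∈ Ioi (0 : ℝ), HasDerivAt (fun t : ℝ =>
      (t : ℂ) ^ m * ((1 + k ^ 2 * t ^ 2 : ℝ) : ℂ) ^ (-(m / 2)) / m)
      ((t : ℂ) ^ (m - 1) * ((1 + k ^ 2 * t ^ 2 : ℝ) : ℂ) ^ (-(m / 2) - 1)) t := by
    intro t ht
    have ht' : 0 < t := ht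
    have h1 : HasDerivAt (fun t : ℝ => 1 + k ^ 2 * t ^ 2) (k ^ 2 * (2 * t)) t := by
      simpa using (((hasDerivAt_id t).pow 2).const_mul (k ^ 2)).const_add 1
    refine (((hasDerivAt_ofReal_cpow (hasDerivAt_id t) ht' m).mul
      (hasDerivAt_ofReal_cpow h1 (hu t) (-(m / 2)))).div_const m).congr_deriv ?_
    have e1 : (t : ℂ) ^ m = t * (t : ℂ) ^ (m - 1) := by
      have := Complex.cpow_add 1 (m - 1) (Complex.ofReal_ne_zero.2 ht'.ne')
      rwa [Complex.cpow_one, add_sub_cancel] at this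
    have e2 : ((1 + k ^ 2 * t ^ 2 : ℝ) : ℂ) ^ (-(m / 2)) =
        (1 + k ^ 2 * t ^ 2 : ℝ) * ((1 + k ^ 2 * t ^ 2 : ℝ) : ℂ) ^ (-(m / 2) - 1) := by
      have := Complex.cpow_add 1 (-(m / 2) - 1) (Complex.ofReal_ne_zero.2 (hu t).ne')
      rwa [Complex.cpow_one, add_sub_cancel] at this
    simp only [id]
    rw [e1, e2]
    generalize ((1 + k ^ 2 * t ^ 2 : ℝ) : ℂ) ^ (-(m / 2) - 1) = U
    generalize (t : ℂ) ^ (m - 1) = V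
    push_cast
    field_simp
    ring
  have hl : Tendsto (fun t : ℝ => (t : ℂ) ^ m * ((1 + k ^ 2 * t ^ 2 : ℝ) : ℂ) ^ (-(m / 2)) / m)
      atTop (𝓝 ((k : ℂ) ^ (-m) / m)) := by
    refine Tendsto.div_const ?_ m
    have h1 : Tendsto (fun t : ℝ => (t ^ 2)⁻¹ + k ^ 2) atTop (𝓝 (0 + k ^ 2)) :=
      (tendsto_inv_atTop_zero.comp (tendsto_pow_atTop two_ne_zero)).add_const _
    have h2 : Tendsto (fun t : ℝ => (((t ^ 2)⁻¹ + k ^ 2 : ℝ) : ℂ) ^ (-(m / 2))) atTop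
        (𝓝 (((0 + k ^ 2 : ℝ) : ℂ) ^ (-(m / 2)))) := by
      refine ((Complex.continuous_ofReal.tendsto _).comp h1).cpow tendsto_const_nhds ?_
      exact Complex.ofReal_mem_slitPlane.2 (by positivity)
    have e : (((0 + k ^ 2 : ℝ) : ℂ) ^ (-(m / 2))) = (k : ℂ) ^ (-m) := by
      rw [zero_add, ofReal_sq_cpow hk]
      ring_nf
    rw [e] at h2
    refine h2.congr' ?_
    filter_upwards [eventually_gt_atTop 0] with t ht
    -- Factoring out `t²` cancels `t^m` and leaves `(t⁻² + k²)^(-m/2)`.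
    have e1 : (1 + k ^ 2 * t ^ 2 : ℝ) = t ^ 2 * ((t ^ 2)⁻¹ + k ^ 2) := by field_simp
    rw [e1, Complex.ofReal_mul, Complex.mul_cpow_ofReal_nonneg (by positivity) (by positivity),
      ← mul_assoc, ofReal_sq_cpow ht, ← Complex.cpow_add _ _ (Complex.ofReal_ne_zero.2 ht.ne')]
    ring_nf
    simp
  rw [integral_Ioi_of_hasDerivAt_of_tendsto hcont.continuousWithinAt hd hi hl]
  simp [hm0]

/-! ### Removing the regularization from the kernel -/

theorem integrable_norm_mul_bound (c : ℝ) (a : ℝ × ℝ) (φ : 𝓓(halfPlane, ℂ)) :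
    Integrable fun q : ℝ × ℝ => ‖φ q‖ * (q.1 ^ c * ‖q - a‖⁻¹) := by
  have hK : IsCompact (tsupport φ) := φ.hasCompactSupport
  have h := (locallyIntegrableOn_bound c a).integrableOn_compact_subset φ.tsupport_subset hK
  refine (integrableOn_iff_integrable_of_support_subset ?_).1
    (h.continuousOn_mul φ.continuous.norm.continuousOn hK)
  intro q hq
  refine subset_tsupport φ fun h0 => hq ?_
  simp [h0]

theorem ae_norm_mul_kernelIntegrand_le {m : ℂ} (hm : 1 ≤ m.re) {a : ℝ × ℝ} (ha : 0 < a.1)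
    (φ : 𝓓(halfPlane, ℂ)) : ∀ᵐ z ∂((volume : Measure (ℝ × ℝ)).prod angleMeasure), ∀ ε,
      ‖φ z.1 * kernelIntegrand m a ε z.1 z.2‖ ≤
        ‖φ z.1‖ * (z.1.1 ^ (1 - m.re) * ‖z.1 - a‖⁻¹) := by
  filter_upwards [ae_prod_angleMeasure (Measure.ae_ne volume a)] with z hz ε
  by_cases hq : z.1 ∈ halfPlane
  · rw [norm_mul]
    gcongr
    exact norm_kernelIntegrand_le hm ha hq hz.1 ε hz.2
  · simp [testFunction_eq_zero φ hq]

theorem aestronglyMeasurable_mul_kernelIntegrand (m : ℂ) (a : ℝ × ℝ) (φ : 𝓓(halfPlane, ℂ))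
    (ε : ℝ) : AEStronglyMeasurable
      (fun z : (ℝ × ℝ) × ℝ => φ z.1 * kernelIntegrand m a ε z.1 z.2)
      ((volume : Measure (ℝ × ℝ)).prod angleMeasure) :=
  ((φ.continuous.comp continuous_fst).measurable.mul
    (measurable_kernelIntegrand m a ε)).aestronglyMeasurable

/-- The regularized kernels converge to the kernel as distributions. -/
theorem tendsto_integral_mul_kernelIntegrand {m : ℂ} (hm : 1 ≤ m.re) {a : ℝ × ℝ} (ha : 0 < a.1)
    (φ : 𝓓(halfPlane, ℂ)) :
    Tendsto (fun ε => ∫ z : (ℝ × ℝ) × ℝ, φ z.1 * kernelIntegrand m a ε z.1 z.2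
      ∂(volume.prod angleMeasure)) (𝓝[>] 0)
      (𝓝 (∫ q, φ q * ∫ θ, kernelIntegrand m a 0 q θ ∂angleMeasure)) := by
  have hb := (integrable_norm_mul_bound (1 - m.re) a φ).comp_fst angleMeasure
  have hle := ae_norm_mul_kernelIntegrand_le hm ha φ
  have hi : Integrable (fun z : (ℝ × ℝ) × ℝ => φ z.1 * kernelIntegrand m a 0 z.1 z.2)
      (volume.prod angleMeasure) :=
    hb.mono' (aestronglyMeasurable_mul_kernelIntegrand m a φ 0) (hle.mono fun z h => h 0)
  have e : ∫ q, φ q * ∫ θ, kernelIntegrand m a 0 q θ ∂angleMeasure =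
      ∫ z : (ℝ × ℝ) × ℝ, φ z.1 * kernelIntegrand m a 0 z.1 z.2 ∂(volume.prod angleMeasure) := by
    rw [integral_prod _ hi]
    simp only [integral_const_mul]
  rw [e]
  refine tendsto_integral_filter_of_dominated_convergence _
    (.of_forall fun ε => aestronglyMeasurable_mul_kernelIntegrand m a φ ε)
    (.of_forall fun ε => hle.mono fun z h => h ε) hb ?_
  filter_upwards [ae_prod_angleMeasure (Measure.ae_ne volume a)] with z hz
  by_cases hq : z.1 ∈ halfPlane
  · refine Tendsto.const_mul _ (Tendsto.const_mul _ ?_)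
    have h1 : Tendsto (fun ε => (regBracket a ε z.1 z.2 : ℂ)) (𝓝[>] 0)
        (𝓝 (regBracket a 0 z.1 z.2 : ℂ)) := by
      have : Continuous fun ε => (regBracket a ε z.1 z.2 : ℂ) := by
        unfold regBracket
        fun_prop
      exact (this.tendsto 0).mono_left nhdsWithin_le_nhds
    exact h1.cpow tendsto_const_nhds
      (Complex.ofReal_mem_slitPlane.2 (regBracket_pos_of_ne ha hq hz.1 0 z.2))
  · simp [testFunction_eq_zero φ hq]

/-! ### Rescaling at the singularity: the approximate identity -/

/-- The quotient of `regBracket` by `ε²` in the variables centred at `(a, 0)` and dilated by `ε`. -/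
def scaledBracket (a : ℝ × ℝ) (ε : ℝ) (v : (ℝ × ℝ) × ℝ) : ℝ :=
  1 + v.1.1 ^ 2 + v.1.2 ^ 2 + 4 * a.1 * (a.1 + ε * v.1.1) * (ε⁻¹ * Real.sin (ε * (v.2 / 2))) ^ 2

theorem regBracket_eq_sq_mul_scaledBracket (a : ℝ × ℝ) {ε : ℝ} (hε : 0 < ε) (v : (ℝ × ℝ) × ℝ) :
    regBracket a ε (a + ε • v.1) (ε * v.2) = ε ^ 2 * scaledBracket a ε v := by
  have e : ε * v.2 / 2 = ε * (v.2 / 2) := by ring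
  simp only [regBracket, bracket, scaledBracket, Prod.fst_add, Prod.snd_add, Prod.smul_fst,
    Prod.smul_snd, smul_eq_mul, e]
  field_simp
  ring

/-- The limit of `scaledBracket` as `ε` tends to zero. -/
def limitBracket (a : ℝ × ℝ) (v : (ℝ × ℝ) × ℝ) : ℝ :=
  1 + a.1 ^ 2 * v.2 ^ 2 + (v.1.1 ^ 2 + v.1.2 ^ 2)

theorem limitBracket_pos (a : ℝ × ℝ) (v : (ℝ × ℝ) × ℝ) : 0 < limitBracket a v := by
  unfold limitBracket
  positivity

theorem tendsto_inv_mul_sin (t : ℝ) :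
    Tendsto (fun ε : ℝ => ε⁻¹ * Real.sin (ε * t)) (𝓝[>] 0) (𝓝 t) := by
  have h : HasDerivAt (fun ε : ℝ => Real.sin (ε * t)) t 0 := by
    have := ((hasDerivAt_id (0 : ℝ)).mul_const t).sin
    simpa using this
  simpa using h.tendsto_slope_zero_right

theorem tendsto_scaledBracket (a : ℝ × ℝ) (v : (ℝ × ℝ) × ℝ) :
    Tendsto (fun ε => scaledBracket a ε v) (𝓝[>] 0) (𝓝 (limitBracket a v)) := by
  have h1 : Tendsto (fun ε : ℝ => a.1 + ε * v.1.1) (𝓝[>] 0) (𝓝 a.1) := by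
    have : Continuous fun ε : ℝ => a.1 + ε * v.1.1 := by fun_prop
    simpa using (this.tendsto 0).mono_left nhdsWithin_le_nhds
  have h2 := (((h1.const_mul (4 * a.1)).mul ((tendsto_inv_mul_sin (v.2 / 2)).pow 2)).const_add
    (1 + v.1.1 ^ 2 + v.1.2 ^ 2))
  have e : limitBracket a v = 1 + v.1.1 ^ 2 + v.1.2 ^ 2 + 4 * a.1 * a.1 * (v.2 / 2) ^ 2 := by
    unfold limitBracket; ring
  rw [e]
  exact h2

theorem one_add_norm_sq_le (v : (ℝ × ℝ) × ℝ) {c W : ℝ} (hc : c ≤ 1)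
    (hW : 1 + v.1.1 ^ 2 + v.1.2 ^ 2 + c * v.2 ^ 2 ≤ W) (hc0 : 0 < c) :
    c * (1 + ‖v‖ ^ 2) ≤ W := by
  refine le_trans ?_ hW
  have h1 : ‖v‖ ^ 2 = v.1.1 ^ 2 ∨ ‖v‖ ^ 2 = v.1.2 ^ 2 ∨ ‖v‖ ^ 2 = v.2 ^ 2 := by
    rw [Prod.norm_def, Prod.norm_def]
    rcases max_choice (max ‖v.1.1‖ ‖v.1.2‖) ‖v.2‖ with h | h <;> rw [h]
    · rcases max_choice ‖v.1.1‖ ‖v.1.2‖ with h | h <;> rw [h] <;> simp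
    · simp
  rcases h1 with h | h | h <;> rw [h] <;>
  nlinarith [sq_nonneg v.1.1, sq_nonneg v.1.2, sq_nonneg v.2]

/-- The growth of `T^(m-1)` costs `(Re m - 1)/2` powers of `1 + N²` against a decay of `Re m / 2 +
2`, leaving `-5/2` whatever `m` is. This is integrable in dimension `3`. -/
theorem norm_cpow_mul_cpow_le {m : ℂ} (hm : 1 ≤ m.re) {c T W N : ℝ} (hc : 0 < c) (hT : 0 < T)
    (hTN : T ≤ N) (hW : c * (1 + N ^ 2) ≤ W) :
    ‖(T : ℂ) ^ (m - 1) * (W : ℂ) ^ (-(m / 2) - 2)‖ ≤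
      c ^ (-(m.re / 2) - 2) * (1 + N ^ 2) ^ (-(5 : ℝ) / 2) := by
  have hN : 0 < 1 + N ^ 2 := by positivity
  have hWp : 0 < W := (mul_pos hc hN).trans_le hW
  have e2 : (-(m / 2) - 2).re = -(m.re / 2) - 2 := by
    have : (m / 2).re = m.re / 2 := by simp
    rw [Complex.sub_re, Complex.neg_re, this]; simp
  have e1 : (m - 1).re = m.re - 1 := by simp
  rw [norm_mul, Complex.norm_cpow_eq_rpow_re_of_pos hT, Complex.norm_cpow_eq_rpow_re_of_pos hWp,
    e1, e2]
  have h1 : T ^ (m.re - 1) ≤ (1 + N ^ 2) ^ ((m.re - 1) / 2) := by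
    calc T ^ (m.re - 1) = (T ^ 2) ^ ((m.re - 1) / 2) := by
          rw [← Real.rpow_natCast_mul hT.le]
          congr 1; push_cast; ring
      _ ≤ _ := Real.rpow_le_rpow (by positivity) (by nlinarith) (by linarith)
  have h2 : W ^ (-(m.re / 2) - 2) ≤ c ^ (-(m.re / 2) - 2) * (1 + N ^ 2) ^ (-(m.re / 2) - 2) := by
    rw [← Real.mul_rpow hc.le hN.le]
    exact Real.rpow_le_rpow_of_nonpos (mul_pos hc hN) hW (by linarith)
  calc _ ≤ (1 + N ^ 2) ^ ((m.re - 1) / 2) *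
        (c ^ (-(m.re / 2) - 2) * (1 + N ^ 2) ^ (-(m.re / 2) - 2)) := by gcongr
    _ = c ^ (-(m.re / 2) - 2) * ((1 + N ^ 2) ^ ((m.re - 1) / 2) *
        (1 + N ^ 2) ^ (-(m.re / 2) - 2)) := by ring
    _ = _ := by
        rw [← Real.rpow_add hN]
        congr 2; ring

instance : (volume : Measure ((ℝ × ℝ) × ℝ)).IsAddHaarMeasure :=
  Measure.prod.instIsAddHaarMeasure volume volume

theorem integrable_one_add_norm_sq_rpow :
    Integrable (fun v : (ℝ × ℝ) × ℝ => (1 + ‖v‖ ^ 2) ^ (-(5 : ℝ) / 2)) :=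
  integrable_rpow_neg_one_add_norm_sq (by norm_num)

/-- The limit profile of the approximate identity. -/
def profile (m : ℂ) (a : ℝ × ℝ) (v : (ℝ × ℝ) × ℝ) : ℂ :=
  (Ioi (0 : ℝ)).indicator
    (fun t => (t : ℂ) ^ (m - 1) * (limitBracket a (v.1, t) : ℂ) ^ (-(m / 2) - 2)) v.2

theorem profile_of_pos (m : ℂ) (a : ℝ × ℝ) {v : (ℝ × ℝ) × ℝ} (hv : 0 < v.2) :
    profile m a v = (v.2 : ℂ) ^ (m - 1) * (limitBracket a v : ℂ) ^ (-(m / 2) - 2) :=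
  indicator_of_mem (s := Ioi 0) hv _

theorem profile_of_not_pos (m : ℂ) (a : ℝ × ℝ) {v : (ℝ × ℝ) × ℝ} (hv : ¬0 < v.2) :
    profile m a v = 0 :=
  indicator_of_notMem (s := Ioi 0) hv _

theorem integrable_profile {m : ℂ} (hm : 1 ≤ m.re) {a : ℝ × ℝ} (ha : 0 < a.1) :
    Integrable (profile m a) := by
  set c := min 1 (a.1 ^ 2) with hc
  have hc0 : 0 < c := lt_min one_pos (by positivity)
  refine (integrable_one_add_norm_sq_rpow.const_mul (c ^ (-(m.re / 2) - 2))).mono' ?_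
    (.of_forall fun v => ?_)
  · unfold profile limitBracket
    refine Measurable.aestronglyMeasurable ?_
    have : Measurable fun v : (ℝ × ℝ) × ℝ => (v.2 : ℂ) ^ (m - 1) *
      ((1 + a.1 ^ 2 * v.2 ^ 2 + (v.1.1 ^ 2 + v.1.2 ^ 2) : ℝ) : ℂ) ^ (-(m / 2) - 2) := by fun_prop
    exact this.indicator (measurableSet_Ioi.preimage measurable_snd)
  · by_cases hv : 0 < v.2
    · rw [profile_of_pos m a hv]
      refine norm_cpow_mul_cpow_le hm hc0 hv ((le_abs_self _).trans (norm_snd_le v)) ?_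
      refine one_add_norm_sq_le v (min_le_left _ _) ?_ hc0
      have : c * v.2 ^ 2 ≤ a.1 ^ 2 * v.2 ^ 2 := by gcongr; exact min_le_right _ _
      simp only [limitBracket]
      linarith
    · rw [profile_of_not_pos m a hv, norm_zero]
      positivity

/-- Integrating over the plane first, in polar coordinates, gives the factor `2π/(m+2)`; the
remaining integral over `t` gives `a₁^(-m)/m`. -/
theorem integral_profile {m : ℂ} (hm : 1 ≤ m.re) {a : ℝ × ℝ} (ha : 0 < a.1) :
    ∫ v, profile m a v = 2 * Real.pi / (m * (m + 2)) * (a.1 : ℂ) ^ (-m) := by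
  have hm0 : m ≠ 0 := by rintro rfl; simp at hm; linarith
  have hm2 : m + 2 ≠ 0 := by
    intro h
    have := congrArg Complex.re h
    simp at this
    linarith
  have hi := integrable_profile hm ha
  have hw : (-(m / 2) - 1).re < 0 := by
    have : (m / 2).re = m.re / 2 := by simp
    rw [Complex.sub_re, Complex.neg_re, this]; simp; linarith
  have hw0 : -(m / 2) - 1 ≠ 0 := by intro h; rw [h] at hw; simp at hw
  have e : (fun t => ∫ q, profile m a (q, t)) = (Ioi (0 : ℝ)).indicator fun t =>
      -(Real.pi / (-(m / 2) - 1)) * ((t : ℂ) ^ (m - 1) *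
        ((1 + a.1 ^ 2 * t ^ 2 : ℝ) : ℂ) ^ (-(m / 2) - 1)) := by
    funext t
    by_cases ht : t ∈ Ioi (0 : ℝ)
    · simp only [profile, indicator_of_mem ht, limitBracket, integral_const_mul]
      have e2 : -(m / 2) - 2 = -(m / 2) - 1 - 1 := by ring
      rw [e2, integral_add_sq_add_sq_cpow (by positivity) hw]
      ring
    · simp [profile, indicator_of_notMem ht]
  have hi' := hi.integral_prod_right
  rw [Measure.volume_eq_prod, integral_prod_symm _ hi]
  change Integrable (fun t => ∫ q, profile m a (q, t)) at hi'
  change ∫ t, (fun t => ∫ q, profile m a (q, t)) t = _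
  rw [e] at hi' ⊢
  rw [integrable_indicator_iff measurableSet_Ioi] at hi'
  have hp : -((Real.pi : ℂ) / (-(m / 2) - 1)) ≠ 0 :=
    neg_ne_zero.2 (div_ne_zero (Complex.ofReal_ne_zero.2 Real.pi_ne_zero) hw0)
  -- Fubini gives integrability of the inner integral; dividing by its nonzero constant gives that
  -- of the integrand in `t`.
  have hi2 := (integrable_const_mul_iff hp.isUnit _).1 hi'
  rw [integral_indicator measurableSet_Ioi, integral_const_mul,
    integral_cpow_mul_one_add_sq_cpow (by linarith) ha hi2]
  have e3 : -(m / 2) - 1 = -((m + 2) / 2) := by ring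
  rw [e3]
  field_simp

/-- The approximate identity in the variables centred at `(a, 0)` and dilated by `ε`. -/
def scaledIntegrand (m : ℂ) (a : ℝ × ℝ) (ψ : ℝ × ℝ → ℂ) (ε : ℝ) (v : (ℝ × ℝ) × ℝ) : ℂ :=
  {v : (ℝ × ℝ) × ℝ | ε * v.2 ∈ Ioo 0 Real.pi}.indicator (fun v => ψ (a + ε • v.1) *
    (((ε⁻¹ * Real.sin (ε * v.2) : ℝ) : ℂ) ^ (m - 1) *
      (scaledBracket a ε v : ℂ) ^ (-(m / 2) - 2))) v

theorem scaledIntegrand_of_mem (m : ℂ) (a : ℝ × ℝ) (ψ : ℝ × ℝ → ℂ) {ε : ℝ} {v : (ℝ × ℝ) × ℝ}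
    (hv : ε * v.2 ∈ Ioo 0 Real.pi) : scaledIntegrand m a ψ ε v = ψ (a + ε • v.1) *
    (((ε⁻¹ * Real.sin (ε * v.2) : ℝ) : ℂ) ^ (m - 1) *
      (scaledBracket a ε v : ℂ) ^ (-(m / 2) - 2)) :=
  indicator_of_mem (s := {v : (ℝ × ℝ) × ℝ | ε * v.2 ∈ Ioo 0 Real.pi}) hv _

theorem scaledIntegrand_of_notMem (m : ℂ) (a : ℝ × ℝ) (ψ : ℝ × ℝ → ℂ) {ε : ℝ} {v : (ℝ × ℝ) × ℝ}
    (hv : ε * v.2 ∉ Ioo 0 Real.pi) : scaledIntegrand m a ψ ε v = 0 :=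
  indicator_of_notMem (s := {v : (ℝ × ℝ) × ℝ | ε * v.2 ∈ Ioo 0 Real.pi}) hv _

/-- Substitution of `q = a + ε v`, `θ = ε t`. The sign condition on `scaledBracket` allows the
complex power of `ε² * scaledBracket` to be split. -/
theorem sq_mul_integral_eq_integral_scaledIntegrand (m : ℂ) (a : ℝ × ℝ) (ψ : ℝ × ℝ → ℂ) {ε : ℝ}
    (hε : 0 < ε) (hψ : ∀ v : (ℝ × ℝ) × ℝ, ψ (a + ε • v.1) ≠ 0 → 0 ≤ scaledBracket a ε v) :
    (ε : ℂ) ^ 2 * ∫ z : (ℝ × ℝ) × ℝ, ψ z.1 * ((Real.sin z.2 : ℂ) ^ (m - 1) *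
      (regBracket a ε z.1 z.2 : ℂ) ^ (-(m / 2) - 2)) ∂(volume.prod angleMeasure) =
      ∫ v, scaledIntegrand m a ψ ε v := by
  set F : (ℝ × ℝ) × ℝ → ℂ := fun z => ψ z.1 * ((Real.sin z.2 : ℂ) ^ (m - 1) *
      (regBracket a ε z.1 z.2 : ℂ) ^ (-(m / 2) - 2)) with hF
  set S : Set ((ℝ × ℝ) × ℝ) := univ ×ˢ Ioo 0 Real.pi
  have hS : MeasurableSet S := MeasurableSet.univ.prod measurableSet_Ioo
  have h1 : ∫ z, F z ∂(volume.prod angleMeasure) = ∫ z, S.indicator F z := by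
    rw [integral_indicator hS, Measure.volume_eq_prod (ℝ × ℝ) ℝ, ← Measure.prod_restrict,
      Measure.restrict_univ]
  have h2 : ∫ z, S.indicator F z = (ε : ℂ) ^ 3 * ∫ v, S.indicator F ((a, 0) + ε • v) := by
    rw [Measure.integral_comp_smul volume (fun z => S.indicator F ((a, 0) + z)) ε,
      integral_add_left_eq_self]
    have : Module.finrank ℝ ((ℝ × ℝ) × ℝ) = 3 := by simp
    rw [this, abs_of_pos (by positivity), Complex.real_smul]
    push_cast
    rw [mul_inv_cancel_left₀]
    exact pow_ne_zero 3 (Complex.ofReal_ne_zero.2 hε.ne')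
  rw [h1, h2, ← mul_assoc, ← integral_const_mul]
  refine integral_congr_ae (.of_forall fun v => ?_)
  have hε0 : (ε : ℂ) ≠ 0 := Complex.ofReal_ne_zero.2 hε.ne'
  by_cases hv : ε * v.2 ∈ Ioo 0 Real.pi
  · have hv' : (a, 0) + ε • v ∈ S := ⟨mem_univ _, by simpa using hv⟩
    have hs : 0 < Real.sin (ε * v.2) := Real.sin_pos_of_mem_Ioo hv
    simp only [scaledIntegrand_of_mem m a ψ hv, indicator_of_mem hv']
    have e1 : ((a, (0 : ℝ)) + ε • v).1 = a + ε • v.1 := rfl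
    have e2 : ((a, (0 : ℝ)) + ε • v).2 = ε * v.2 := by simp
    simp only [hF, e1, e2]
    by_cases h0 : ψ (a + ε • v.1) = 0
    · simp [h0]
    have e3 : (Real.sin (ε * v.2) : ℂ) ^ (m - 1) = (ε : ℂ) ^ (m - 1) *
        ((ε⁻¹ * Real.sin (ε * v.2) : ℝ) : ℂ) ^ (m - 1) := by
      rw [← Complex.mul_cpow_ofReal_nonneg hε.le (by positivity), ← Complex.ofReal_mul,
        mul_inv_cancel_left₀ hε.ne']
    -- The power `ε⁻⁵` cancels the prefactor `ε²` and the Jacobian `ε³`.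
    have e4 : (ε : ℂ) ^ (m - 1) * (ε : ℂ) ^ (2 * (-(m / 2) - 2)) = ((ε : ℂ) ^ 5)⁻¹ := by
      rw [← Complex.cpow_add _ _ hε0, ← Complex.cpow_ofNat, ← Complex.cpow_neg]
      ring_nf
    rw [regBracket_eq_sq_mul_scaledBracket a hε, Complex.ofReal_mul,
      Complex.mul_cpow_ofReal_nonneg (by positivity) (hψ v h0), ofReal_sq_cpow hε, e3]
    calc _ = ((ε : ℂ) ^ (m - 1) * (ε : ℂ) ^ (2 * (-(m / 2) - 2))) * (ε : ℂ) ^ 5 *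
          (ψ (a + ε • v.1) * (((ε⁻¹ * Real.sin (ε * v.2) : ℝ) : ℂ) ^ (m - 1) *
            (scaledBracket a ε v : ℂ) ^ (-(m / 2) - 2))) := by ring
      _ = _ := by rw [e4, inv_mul_cancel₀ (pow_ne_zero 5 hε0), one_mul]
  · have hv' : (a, 0) + ε • v ∉ S := fun h => hv (by simpa using h.2)
    simp only [scaledIntegrand_of_notMem m a ψ hv, indicator_of_notMem hv', mul_zero]

theorem exists_pos_le_fst (ψ : 𝓓(halfPlane, ℂ)) : ∃ δ > 0, ∀ q, ψ q ≠ 0 → δ ≤ q.1 := by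
  rcases (tsupport ψ).eq_empty_or_nonempty with h | h
  · refine ⟨1, one_pos, fun q hq => ?_⟩
    have := subset_tsupport ψ hq
    simp [h] at this
  · obtain ⟨p, hp, hmin⟩ := ψ.hasCompactSupport.isCompact.exists_isMinOn h continuousOn_fst
    exact ⟨p.1, ψ.tsupport_subset hp, fun q hq => hmin (subset_tsupport ψ hq)⟩

/-- Jordan's inequality `sin s ≥ 2s/π` applies because the half-angle is below `π/2`; `δ` keeps the
factor `a₁ + ε v₁` away from zero. -/
theorem one_add_sq_le_scaledBracket {a : ℝ × ℝ} (ha : 0 < a.1) {δ ε : ℝ}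
    {v : (ℝ × ℝ) × ℝ} (hε : 0 < ε) (hδ : 0 < δ) (hq : δ ≤ a.1 + ε * v.1.1)
    (hv : ε * v.2 ∈ Ioo 0 Real.pi) :
    1 + v.1.1 ^ 2 + v.1.2 ^ 2 + 4 * a.1 * δ / Real.pi ^ 2 * v.2 ^ 2 ≤ scaledBracket a ε v := by
  have h1 : 2 / Real.pi * (ε * (v.2 / 2)) ≤ Real.sin (ε * (v.2 / 2)) :=
    Real.mul_le_sin (by linarith [hv.1]) (by linarith [hv.2])
  have hv0 : 0 < v.2 := pos_of_mul_pos_right hv.1 hε.le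
  have h2 : v.2 / Real.pi ≤ ε⁻¹ * Real.sin (ε * (v.2 / 2)) := by
    calc v.2 / Real.pi = ε⁻¹ * (2 / Real.pi * (ε * (v.2 / 2))) := by field_simp
      _ ≤ _ := by gcongr
  have h3 : 4 * a.1 * δ * (v.2 / Real.pi) ^ 2 ≤
      4 * a.1 * (a.1 + ε * v.1.1) * (ε⁻¹ * Real.sin (ε * (v.2 / 2))) ^ 2 := by
    have := Real.pi_pos
    have : 0 ≤ a.1 + ε * v.1.1 := hδ.le.trans hq
    gcongr
  unfold scaledBracket
  have e : 4 * a.1 * δ / Real.pi ^ 2 * v.2 ^ 2 = 4 * a.1 * δ * (v.2 / Real.pi) ^ 2 := by ring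
  rw [e]
  linarith

theorem measurable_scaledIntegrand (m : ℂ) (a : ℝ × ℝ) {ψ : ℝ × ℝ → ℂ} (hψ : Measurable ψ)
    (ε : ℝ) : Measurable (scaledIntegrand m a ψ ε) := by
  unfold scaledIntegrand scaledBracket
  refine Measurable.indicator (by fun_prop) ?_
  exact measurableSet_Ioo.preimage (measurable_const.mul measurable_snd)

theorem tendsto_integral_scaledIntegrand {m : ℂ} (hm : 1 ≤ m.re) {a : ℝ × ℝ} (ha : 0 < a.1)
    (ψ : 𝓓(halfPlane, ℂ)) :
    Tendsto (fun ε => ∫ v, scaledIntegrand m a ψ ε v) (𝓝[>] 0)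
      (𝓝 (∫ v, ψ a * profile m a v)) := by
  obtain ⟨δ, hδ, hψδ⟩ := exists_pos_le_fst ψ
  obtain ⟨C, hC⟩ := ψ.hasCompactSupport.exists_bound_of_continuous ψ.continuous
  have hC0 : 0 ≤ C := (norm_nonneg _).trans (hC a)
  -- The second entry is the coefficient of `t²` in `one_add_sq_le_scaledBracket`; the minimum with
  -- `1` gives a bound by the full norm.
  set c := min 1 (4 * a.1 * δ / Real.pi ^ 2) with hc
  have hc0 : 0 < c := lt_min one_pos (by have := Real.pi_pos; positivity)
  refine tendsto_integral_filter_of_dominated_convergence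
    (fun v => C * (c ^ (-(m.re / 2) - 2) * (1 + ‖v‖ ^ 2) ^ (-(5 : ℝ) / 2)))
    (.of_forall fun ε => (measurable_scaledIntegrand m a
      ψ.continuous.measurable ε).aestronglyMeasurable) ?_
    ((integrable_one_add_norm_sq_rpow.const_mul _).const_mul C) ?_
  · filter_upwards [self_mem_nhdsWithin] with ε hε
    refine .of_forall fun v => ?_
    have hε' : 0 < ε := hε
    by_cases hv : ε * v.2 ∈ Ioo 0 Real.pi
    · rw [scaledIntegrand_of_mem m a ψ hv]
      by_cases h0 : ψ (a + ε • v.1) = 0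
      · rw [h0, zero_mul, norm_zero]
        positivity
      rw [norm_mul]
      have hs : 0 < Real.sin (ε * v.2) := Real.sin_pos_of_mem_Ioo hv
      have hT : ε⁻¹ * Real.sin (ε * v.2) ≤ ‖v‖ := by
        calc ε⁻¹ * Real.sin (ε * v.2) ≤ ε⁻¹ * (ε * v.2) := by
              gcongr
              exact Real.sin_le hv.1.le
          _ = v.2 := by field_simp
          _ ≤ _ := (le_abs_self _).trans (norm_snd_le v)
      have hW : c * (1 + ‖v‖ ^ 2) ≤ scaledBracket a ε v := by
        refine one_add_norm_sq_le v (min_le_left _ _) ?_ hc0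
        refine le_trans ?_ (one_add_sq_le_scaledBracket ha hε' hδ
          (by simpa using hψδ _ h0) hv)
        gcongr
        exact min_le_right _ _
      gcongr
      · exact hC _
      · exact norm_cpow_mul_cpow_le hm hc0 (by positivity) hT hW
    · rw [scaledIntegrand_of_notMem m a ψ hv, norm_zero]
      positivity
  · refine .of_forall fun v => ?_
    by_cases hv : 0 < v.2
    · have hlt : ∀ᶠ ε in 𝓝[>] (0 : ℝ), ε * v.2 ∈ Ioo 0 Real.pi := by
        have h1 : Tendsto (fun ε : ℝ => ε * v.2) (𝓝[>] 0) (𝓝 0) := by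
          have : Continuous fun ε : ℝ => ε * v.2 := by fun_prop
          simpa using (this.tendsto 0).mono_left nhdsWithin_le_nhds
        filter_upwards [h1.eventually_lt_const Real.pi_pos, self_mem_nhdsWithin] with ε h2 h3
        exact ⟨mul_pos h3 hv, h2⟩
      have hψ : Tendsto (fun ε : ℝ => ψ (a + ε • v.1)) (𝓝[>] 0) (𝓝 (ψ a)) := by
        have : Continuous fun ε : ℝ => ψ (a + ε • v.1) := ψ.continuous.comp (by fun_prop)
        simpa using (this.tendsto 0).mono_left nhdsWithin_le_nhds
      have hT : Tendsto (fun ε : ℝ => ((ε⁻¹ * Real.sin (ε * v.2) : ℝ) : ℂ) ^ (m - 1)) (𝓝[>] 0)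
          (𝓝 ((v.2 : ℂ) ^ (m - 1))) :=
        ((Complex.continuous_ofReal.tendsto _).comp (tendsto_inv_mul_sin v.2)).cpow
          tendsto_const_nhds (Complex.ofReal_mem_slitPlane.2 hv)
      have hW : Tendsto (fun ε : ℝ => (scaledBracket a ε v : ℂ) ^ (-(m / 2) - 2)) (𝓝[>] 0)
          (𝓝 ((limitBracket a v : ℂ) ^ (-(m / 2) - 2))) :=
        ((Complex.continuous_ofReal.tendsto _).comp (tendsto_scaledBracket a v)).cpow
          tendsto_const_nhds (Complex.ofReal_mem_slitPlane.2 (limitBracket_pos a v))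
      rw [profile_of_pos m a hv]
      refine (hψ.mul (hT.mul hW)).congr' ?_
      filter_upwards [hlt] with ε hε
      rw [scaledIntegrand_of_mem m a ψ hε]
    · rw [profile_of_not_pos m a hv, mul_zero]
      refine tendsto_const_nhds.congr' ?_
      filter_upwards [self_mem_nhdsWithin] with ε hε
      rw [scaledIntegrand_of_notMem]
      exact fun h => hv (pos_of_mul_pos_right h.1 (le_of_lt hε))

/-! ### The kernel as a fundamental solution -/

/-- For each `ε > 0` the tested regularized kernel equals the rescaled integral times `-m(m+2)`, so
the two limits as `ε → 0` coincide. -/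
theorem integral_adjointTest_mul_kernel {m : ℂ} (hm : 1 ≤ m.re) {a : ℝ × ℝ} (ha : 0 < a.1)
    (ψ : 𝓓(halfPlane, ℂ)) :
    ∫ q, adjointTest m ψ q * ∫ θ, kernelIntegrand m a 0 q θ ∂angleMeasure =
      -(2 * Real.pi * (a.1 : ℂ) ^ (-m) * ψ a) := by
  have h1 := tendsto_integral_mul_kernelIntegrand hm ha (adjointTest m ψ)
  have h2 := (tendsto_integral_scaledIntegrand hm ha ψ).const_mul (-(m * (m + 2)))
  obtain ⟨δ, hδ, hψδ⟩ := exists_pos_le_fst ψ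
  have h3 : (fun ε => ∫ z : (ℝ × ℝ) × ℝ, adjointTest m ψ z.1 * kernelIntegrand m a ε z.1 z.2
      ∂(volume.prod angleMeasure)) =ᶠ[𝓝[>] 0]
      fun ε => -(m * (m + 2)) * ∫ v, scaledIntegrand m a ψ ε v := by
    filter_upwards [self_mem_nhdsWithin] with ε hε
    rw [integral_adjointTest_mul_kernelIntegrand hm a hε,
      ← sq_mul_integral_eq_integral_scaledIntegrand m a ψ hε]
    · ring
    · intro v hv
      have : δ ≤ a.1 + ε * v.1.1 := by simpa using hψδ _ hv
      unfold scaledBracket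
      have : 0 ≤ a.1 + ε * v.1.1 := hδ.le.trans this
      positivity
  rw [tendsto_nhds_unique (h1.congr' h3) h2, integral_const_mul, integral_profile hm ha]
  have hm0 : m ≠ 0 := by rintro rfl; simp at hm; linarith
  have hm2 : m + 2 ≠ 0 := by
    intro h
    have := congrArg Complex.re h
    simp at this
    linarith
  field_simp

theorem weinstein_kernel {m : ℂ} (hm : 1 ≤ m.re) {a : ℝ × ℝ} (ha : 0 < a.1) :
    weinstein m (ofFun (kernel m a)) = (a.1 : ℂ) ^ (-m) • dirac a := by
  ext ψ
  rw [weinstein_apply, ofFun,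
    TestFunction.integralAgainstBilinCLM_eq_integral (locallyIntegrableOn_kernel hm ha)]
  change ∫ q, adjointTest m ψ q * kernel m a q = (a.1 : ℂ) ^ (-m) * ψ a
  have h := integral_adjointTest_mul_kernel hm ha ψ
  simp only [kernel, mul_left_comm (adjointTest m ψ _)]
  rw [integral_const_mul, h]
  have := Complex.ofReal_ne_zero.2 Real.pi_ne_zero
  field_simp

/-! ### From the kernel to `E_m` -/

/-- The bracket is symmetric in its two points, so one equation in `q` serves both variables of
`E_m`. -/
theorem kernel_comm (m : ℂ) (a q : ℝ × ℝ) : kernel m a q = kernel m q a := by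
  unfold kernel kernelIntegrand
  congr! 6
  simp only [regBracket, bracket]
  ring

theorem integrand_eq_of_one_le_re {m : ℂ} (hm : 1 ≤ m.re) (x y ξ η θ : ℝ) :
    integrand m x y ξ η θ = kernelIntegrand m (x, y) 0 (ξ, η) θ := by
  simp [integrand, hm, kernelIntegrand, regBracket, Complex.cpow_neg, div_eq_mul_inv]

theorem integrand_eq_of_re_lt_one {m : ℂ} (hm : m.re < 1) (x y ξ η θ : ℝ) :
    integrand m x y ξ η θ = kernelIntegrand (2 - m) (x, y) 0 (ξ, η) θ := by
  have e1 : 2 - m - 1 = 1 - m := by ring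
  have e2 : (2 - m) / 2 = 1 - m / 2 := by ring
  rw [integrand, if_neg (not_le.2 hm), kernelIntegrand, e1, e2, Complex.cpow_neg,
    div_eq_mul_inv]
  simp [regBracket]

theorem integral_eq_angleMeasure (f : ℝ → ℂ) :
    ∫ θ in (0 : ℝ)..Real.pi, f θ = ∫ θ, f θ ∂angleMeasure := by
  rw [intervalIntegral.integral_of_le Real.pi_pos.le, integral_Ioc_eq_integral_Ioo]

theorem E_eq_of_one_le_re {m : ℂ} (hm : 1 ≤ m.re) (x y ξ η : ℝ) :
    E m x y ξ η = (ξ : ℂ) ^ m * kernel m (x, y) (ξ, η) := by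
  simp only [E, hm, if_true, integrand_eq_of_one_le_re hm, integral_eq_angleMeasure, kernel]
  ring

theorem E_eq_of_re_lt_one {m : ℂ} (hm : m.re < 1) (x y ξ η : ℝ) :
    E m x y ξ η = ξ * (x : ℂ) ^ (1 - m) * kernel (2 - m) (x, y) (ξ, η) := by
  simp only [E, not_le.2 hm, if_false, integrand_eq_of_re_lt_one hm, integral_eq_angleMeasure,
    kernel]
  ring

theorem intervalIntegrable_kernelIntegrand {m : ℂ} (hm : 1 ≤ m.re) {a q : ℝ × ℝ} (ha : 0 < a.1)
    (hq : 0 < q.1) (hqa : q ≠ a) :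
    IntervalIntegrable (kernelIntegrand m a 0 q) volume 0 Real.pi := by
  rw [intervalIntegrable_iff_integrableOn_Ioo_of_le Real.pi_pos.le]
  refine Integrable.mono' (g := fun _ => q.1 ^ (1 - m.re) * ‖q - a‖⁻¹) (integrable_const _) ?_ ?_
  · exact ((measurable_kernelIntegrand m a 0).comp measurable_prodMk_left).aestronglyMeasurable
  · filter_upwards [ae_restrict_mem measurableSet_Ioo] with θ hθ
    exact norm_kernelIntegrand_le hm ha hq hqa 0 hθ

theorem ofFun_smul (c : ℂ) (f : ℝ × ℝ → ℂ) {Ω : TopologicalSpace.Opens (ℝ × ℝ)}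
    (hf : LocallyIntegrableOn f Ω) : (ofFun (fun p => c * f p) : Distr Ω) = c • ofFun f := by
  have := (smulDistr_ofFun (g := fun _ => c) contDiffOn_const hf).2
  rw [← this]
  ext φ
  change ofFun f _ = c • ofFun f _
  rw [← map_smul]
  congr 1
  ext p
  exact mul_comm _ _

theorem weinstein_smul (m c : ℂ) (T : Distr halfPlane) :
    weinstein m (c • T) = c • weinstein m T := by
  ext φ
  simp [weinstein, partial₁, partial₂, deriv, smulDistr]

theorem weinsteinAdjoint_smul (m c : ℂ) (T : Distr halfPlane) :
    weinsteinAdjoint m (c • T) = c • weinsteinAdjoint m T := by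
  ext φ
  simp [weinsteinAdjoint, partial₁, partial₂, deriv, smulDistr]

theorem powMul_ofFun (c : ℂ) {f : ℝ × ℝ → ℂ} (hf : LocallyIntegrableOn f halfPlane) :
    LocallyIntegrableOn (fun p => (p.1 : ℂ) ^ c * f p) halfPlane ∧
      powMul c (ofFun f) = ofFun fun p => (p.1 : ℂ) ^ c * f p :=
  smulDistr_ofFun (contDiffOn_cpow c) hf

theorem powMul_dirac (c : ℂ) (a : ℝ × ℝ) : powMul c (dirac a) = (a.1 : ℂ) ^ c • dirac a :=
  smulDistr_dirac (contDiffOn_cpow c) a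

theorem weinsteinAdjoint_E (m : ℂ) {x : ℝ} (hx : 0 < x) (y : ℝ) :
    LocallyIntegrableOn (fun q : ℝ × ℝ => E m x y q.1 q.2) halfPlane ∧
      weinsteinAdjoint m (ofFun fun q : ℝ × ℝ => E m x y q.1 q.2) = dirac (x, y) := by
  have hx' : (x : ℂ) ≠ 0 := Complex.ofReal_ne_zero.2 hx.ne'
  rcases le_or_gt 1 m.re with hm | hm
  · have hk := locallyIntegrableOn_kernel hm (a := (x, y)) hx
    simp only [E_eq_of_one_le_re hm]
    refine ⟨(powMul_ofFun m hk).1, ?_⟩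
    rw [← (powMul_ofFun m hk).2, weinsteinAdjoint_powMul, weinstein_kernel hm hx, powMul_smul,
      powMul_dirac, smul_smul, ← Complex.cpow_add _ _ hx']
    simp
  · have hm' : 1 ≤ (2 - m).re := by simp; linarith
    have hk := locallyIntegrableOn_kernel hm' (a := (x, y)) hx
    have hk1 := powMul_ofFun 1 hk
    have e : (fun q : ℝ × ℝ => E m x y q.1 q.2) =
        fun q => (x : ℂ) ^ (1 - m) * ((q.1 : ℂ) ^ (1 : ℂ) * kernel (2 - m) (x, y) q) := by
      funext q
      rw [E_eq_of_re_lt_one hm, Complex.cpow_one]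
      ring
    -- Writing `1 = m + (1 - m)` lets the two conjugations apply in turn, replacing `L_m^⋆` by
    -- `L_{2-m}`.
    have e1 : powMul 1 (ofFun (kernel (2 - m) (x, y))) =
        powMul m (powMul (1 - m) (ofFun (kernel (2 - m) (x, y)))) := by
      rw [powMul_powMul]
      ring_nf
    rw [e]
    refine ⟨(smulDistr_ofFun (g := fun _ => (x : ℂ) ^ (1 - m)) contDiffOn_const hk1.1).1, ?_⟩
    rw [ofFun_smul _ _ hk1.1, weinsteinAdjoint_smul, ← hk1.2]
    rw [e1, weinsteinAdjoint_powMul, weinstein_powMul, weinstein_kernel hm' hx,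
      powMul_smul, powMul_smul, powMul_dirac, powMul_smul, powMul_dirac]
    -- The exponents of `x` are `1 - m`, `-(2 - m)`, `1 - m` and `m`, with sum zero.
    simp only [smul_smul, ← Complex.cpow_add _ _ hx']
    ring_nf
    simp

theorem weinstein_E (m : ℂ) {ξ : ℝ} (hξ : 0 < ξ) (η : ℝ) :
    LocallyIntegrableOn (fun p : ℝ × ℝ => E m p.1 p.2 ξ η) halfPlane ∧
      weinstein m (ofFun fun p : ℝ × ℝ => E m p.1 p.2 ξ η) = dirac (ξ, η) := by
  have hξ' : (ξ : ℂ) ≠ 0 := Complex.ofReal_ne_zero.2 hξ.ne'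
  rcases le_or_gt 1 m.re with hm | hm
  · have hk := locallyIntegrableOn_kernel hm (a := (ξ, η)) hξ
    have e : (fun p : ℝ × ℝ => E m p.1 p.2 ξ η) = fun p => (ξ : ℂ) ^ m * kernel m (ξ, η) p := by
      funext p
      rw [E_eq_of_one_le_re hm, kernel_comm]
    rw [e]
    refine ⟨(smulDistr_ofFun (g := fun _ => (ξ : ℂ) ^ m) contDiffOn_const hk).1, ?_⟩
    rw [ofFun_smul _ _ hk, weinstein_smul, weinstein_kernel hm hξ, smul_smul,
      ← Complex.cpow_add _ _ hξ']
    simp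
  · have hm' : 1 ≤ (2 - m).re := by simp; linarith
    have hk := locallyIntegrableOn_kernel hm' (a := (ξ, η)) hξ
    have hk1 := powMul_ofFun (1 - m) hk
    have e : (fun p : ℝ × ℝ => E m p.1 p.2 ξ η) =
        fun p => (ξ : ℂ) * ((p.1 : ℂ) ^ (1 - m) * kernel (2 - m) (ξ, η) p) := by
      funext p
      rw [E_eq_of_re_lt_one hm, kernel_comm]
      ring
    rw [e]
    refine ⟨(smulDistr_ofFun (g := fun _ => (ξ : ℂ)) contDiffOn_const hk1.1).1, ?_⟩
    rw [ofFun_smul _ _ hk1.1, weinstein_smul, ← hk1.2, weinstein_powMul, weinstein_kernel hm' hξ,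
      powMul_smul, powMul_dirac, smul_smul, smul_smul, mul_assoc, ← Complex.cpow_add _ _ hξ']
    have e2 : -(2 - m) + (1 - m) = -1 := by ring
    rw [e2, Complex.cpow_neg_one, mul_inv_cancel₀ hξ', one_smul]

theorem E_eq_div_cpow_mul {m : ℂ} (hm : m.re < 1) {x ξ : ℝ} (hx : 0 < x) (hξ : 0 < ξ) (y η : ℝ) :
    E m x y ξ η = ((ξ / x : ℝ) : ℂ) ^ (m - 1) * E (2 - m) x y ξ η := by
  have hm' : 1 ≤ (2 - m).re := by simp; linarith
  have hξ' : (ξ : ℂ) ≠ 0 := Complex.ofReal_ne_zero.2 hξ.ne'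
  have h1 : ((ξ / x : ℝ) : ℂ) ^ (m - 1) = (ξ : ℂ) ^ (m - 1) * (x : ℂ) ^ (1 - m) := by
    rw [div_eq_mul_inv, Complex.ofReal_mul, Complex.mul_cpow_ofReal_nonneg hξ.le (by positivity),
      Complex.ofReal_inv, Complex.inv_cpow _ _ (by simp [Complex.arg_ofReal_of_nonneg hx.le,
        Real.pi_pos.ne]), ← Complex.cpow_neg]
    ring_nf
  have h2 : (ξ : ℂ) ^ (m - 1) * (ξ : ℂ) ^ (2 - m) = ξ := by
    rw [← Complex.cpow_add _ _ hξ']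
    ring_nf
    simp
  rw [E_eq_of_re_lt_one hm, E_eq_of_one_le_re hm', h1]
  linear_combination -(x : ℂ) ^ (1 - m) * kernel (2 - m) (x, y) (ξ, η) * h2

end

end Weinstein

theorem mainTheorem3 (m : ℂ) :
    -- the integrals defining `E_m` converge off the diagonal
    (∀ x y ξ η : ℝ, 0 < x → 0 < ξ → (x, y) ≠ (ξ, η) →
      IntervalIntegrable (fun θ => Weinstein.integrand m x y ξ η θ)
        MeasureTheory.volume 0 Real.pi) ∧
    -- the relation between `E_m` and `E_{2-m}`
    (m.re < 1 → ∀ x y ξ η : ℝ, 0 < x → 0 < ξ →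
      Weinstein.E m x y ξ η = ((ξ / x : ℝ) : ℂ) ^ (m - 1) * Weinstein.E (2 - m) x y ξ η) ∧
    -- `L_{m,ξ,η}^⋆ E_m(x, y, ·, ·) = δ_{(x,y)}` on the half-plane, for fixed `(x, y)`
    (∀ x y : ℝ, 0 < x →
      MeasureTheory.LocallyIntegrableOn (fun q : ℝ × ℝ => Weinstein.E m x y q.1 q.2)
        Weinstein.halfPlane MeasureTheory.volume ∧
      Weinstein.weinsteinAdjoint m
          (Weinstein.ofFun (fun q : ℝ × ℝ => Weinstein.E m x y q.1 q.2)) =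
        Weinstein.dirac (x, y)) ∧
    -- `L_{m,x,y} E_m(·, ·, ξ, η) = δ_{(ξ,η)}` on the half-plane, for fixed `(ξ, η)`
    (∀ ξ η : ℝ, 0 < ξ →
      MeasureTheory.LocallyIntegrableOn (fun p : ℝ × ℝ => Weinstein.E m p.1 p.2 ξ η)
        Weinstein.halfPlane MeasureTheory.volume ∧
      Weinstein.weinstein m
          (Weinstein.ofFun (fun p : ℝ × ℝ => Weinstein.E m p.1 p.2 ξ η)) =
        Weinstein.dirac (ξ, η)) := by
  refine ⟨fun x y ξ η hx hξ h => ?_, fun hm x y ξ η hx hξ => Weinstein.E_eq_div_cpow_mul hm hx hξ y η,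
    fun x y hx => Weinstein.weinsteinAdjoint_E m hx y,
    fun ξ η hξ => Weinstein.weinstein_E m hξ η⟩
  rcases le_or_gt 1 m.re with hm | hm
  · simp only [Weinstein.integrand_eq_of_one_le_re hm]
    exact Weinstein.intervalIntegrable_kernelIntegrand hm hx hξ h.symm
  · simp only [Weinstein.integrand_eq_of_re_lt_one hm]
    exact Weinstein.intervalIntegrable_kernelIntegrand (by simp; linarith) hx hξ h.symm
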